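/- Let $k$ be a field of characteristic zero and let $\mathcal B$ be a commutative, not necessarily unital, bialgebra over $k$, with product $\mu$, coproduct $\delta_{\mathcal B}$ and counit $\varepsilon_{\mathcal B}$ (that is, $\mathcal B$ is a commutative associative algebra, possibly without unit, and a coassociative counital coalgebra, with $\delta_{\mathcal B}$ and $\varepsilon_{\mathcal B}$ multiplicative). Notation. Let $T(\mathcal B)^+=\bigoplus_{n\ge 1}T^n(\mathcal B)$, where $T^n(\mathcal B)=\mathcal B^{\otimes n}$, and write $(x_1,\dots,x_n)$ for $x_1\otimes\cdots\otimes x_n$. The free coproduct $\delta(a)=\sum a_{(1)}\otimes a_{(2)}$ of $T^n(\mathcal B)$ maps $(x^1,\dots,x^n)$ to $\sum (x^1_{(1)},\dots,x^n_{(1)})\otimes(x^1_{(2)},\dots,x^n_{(2)})$. For a composition $\rho=(r_1,\dots,r_k)$ of $n$ and $a=(x_1,\dots,x_n)$ put $a|\rho=(x_1,\dots,x_{r_1})(x_{r_1+1},\dots,x_{r_1+r_2})\cdots(x_{n-r_k+1},\dots,x_n)$, a product of $k$ elements of $T(\mathcal B)^+$ in the tensor algebra $T(T(\mathcal B)^+)$,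 and $a/\rho=(x_1\cdots x_{r_1},\,x_{r_1+1}\cdots x_{r_1+r_2},\,\dots,\,x_{n-r_k+1}\cdots x_n)\in T^k(\mathcal B)$. The algebra $T(T(\mathcal B)^+)$ carries the algebra map $\Delta$ with $\Delta a=\sum_{\rho}a_{(1)}|\rho\otimes a_{(2)}/\rho$ for $a\in T^n(\mathcal B)$, $n\ge1$, the sum being over all compositions $\rho$ of $n$, and the algebra map $\varepsilon$ to $k$ with $\varepsilon((x))=\varepsilon_{\mathcal B}(x)$ and $\varepsilon((x_1,\dots,x_n))=0$ for $n>1$. Let $S(T(\mathcal B)^+)$ be the symmetric algebra of the vector space $T(\mathcal B)^+$, i.e. the quotient of $T(T(\mathcal B)^+)$ by the ideal generated by all $ab-ba$ with $a,b\in T(\mathcal B)^+$. For $a=(x_1,\dots,x_n)$ let $\{a\}=\{x_1,\dots,x_n\}=\sum_{\sigma\in\Sigma_n}(x_{\sigma(1)},\dots,x_{\sigma(n)})$, extended linearly to $T(\mathcal B)^+$, and let $S(\mathcal B)^+\subseteq T(\mathcal B)^+$ be the subspace of all elements $\{a\}$, $a\in T(\mathcal B)^+$. Let $\Pi_n$ be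 the set of partitions of $\{1,\dots,n\}$ into nonempty blocks. For $\pi=\{B_1,\dots,B_k\}\in\Pi_n$ and $a=(x_1,\dots,x_n)$ put $\{a|B\}=\{x_{i_1},\dots,x_{i_j}\}$ for a block $B=\{i_1,\dots,i_j\}$, $a|\pi=\{a|B_1\}\cdots\{a|B_k\}\in S(S(\mathcal B)^+)$ and $a/\pi=\bigl\{\prod_{i\in B_1}x_i,\dots,\prod_{i\in B_k}x_i\bigr\}\in S(\mathcal B)^+$; these are extended linearly to $a\in T^n(\mathcal B)$. Theorem. $(T(T(\mathcal B)^+),\Delta,\varepsilon)$ is a bialgebra, and $S(T(\mathcal B)^+)$ is a quotient bialgebra of it: it has a bialgebra structure for which the canonical surjection $T(T(\mathcal B)^+)\to S(T(\mathcal B)^+)$ is a map of bialgebras. The algebra map $S(S(\mathcal B)^+)\to S(T(\mathcal B)^+)$ induced by the inclusion of $S(\mathcal B)^+$ in $T(\mathcal B)^+$ is injective, and it makes the symmetric algebra $S(S(\mathcal B)^+)$ a subbialgebra of $S(T(\mathcal B)^+)$. The coproduct of $S(T(\mathcal B)^+)$, restricted to $S(S(\mathcal B)^+)$, is determined by the formula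 $$\Delta\{a\}=\sum_{\pi\in\Pi_n}a_{(1)}|\pi\otimes a_{(2)}/\pi$$ for all $n\ge 1$ and all $a\in T^n(\mathcal B)$. -/

import Mathlib

open scoped TensorProduct DirectSum

/-- A (not necessarily unital) bialgebra `B` over `k`: an associative algebra, possibly without
unit, and a coassociative counital coalgebra, such that comultiplication and counit are
multiplicative. -/
class IsNonUnitalBialgebra (k B : Type*) [CommSemiring k] [NonUnitalSemiring B] [Module k B]
    [IsScalarTower k B B] [SMulCommClass k B B] [Coalgebra k B] : Prop where
  comul_mul : ∀ x y : B,
    Coalgebra.comul (R := k) (x * y) = Coalgebra.comul (R := k) x * Coalgebra.comul (R := k) y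
  counit_mul : ∀ x y : B,
    Coalgebra.counit (R := k) (x * y) = Coalgebra.counit (R := k) x * Coalgebra.counit (R := k) y

namespace Renormalization

section Bialg

variable {k A A' : Type*} [CommSemiring k] [Semiring A] [Algebra k A] [Semiring A'] [Algebra k A']

/-- The algebra maps `Δ` and `ε` make the algebra `A` a bialgebra: `Δ` is coassociative and `ε` is
a two-sided counit for it. -/
structure IsBialgebra (Δ : A →ₐ[k] A ⊗[k] A) (ε : A →ₐ[k] k) : Prop where
  coassoc : (Algebra.TensorProduct.assoc k k k A A A).toAlgHom.comp
      ((Algebra.TensorProduct.map Δ (AlgHom.id k A)).comp Δ) =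
    (Algebra.TensorProduct.map (AlgHom.id k A) Δ).comp Δ
  counit_left : (Algebra.TensorProduct.map ε (AlgHom.id k A)).comp Δ =
    (Algebra.TensorProduct.lid k A).symm
  counit_right : (Algebra.TensorProduct.map (AlgHom.id k A) ε).comp Δ =
    (Algebra.TensorProduct.rid k k A).symm

/-- The bialgebra, in the sense of Mathlib, given by `IsBialgebra`. -/
abbrev IsBialgebra.toBialgebra {Δ : A →ₐ[k] A ⊗[k] A} {ε : A →ₐ[k] k} (h : IsBialgebra Δ ε) :
    Bialgebra k A :=
  Bialgebra.ofAlgHom Δ ε h.coassoc h.counit_left h.counit_right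

/-- The algebra map `f` is a map of bialgebras from `(A, Δ, ε)` to `(A', Δ', ε')`. -/
structure IsBialgebraMap (Δ : A →ₐ[k] A ⊗[k] A) (ε : A →ₐ[k] k)
    (Δ' : A' →ₐ[k] A' ⊗[k] A') (ε' : A' →ₐ[k] k) (f : A →ₐ[k] A') : Prop where
  map_comul : (Algebra.TensorProduct.map f f).comp Δ = Δ'.comp f
  map_counit : ε'.comp f = ε

end Bialg

noncomputable section

section TensorPart

variable (k B : Type*) [Field k] [NonUnitalRing B] [Module k B]

/-- `T(B)⁺`, the direct sum of the tensor powers `Tⁿ(B)` for `n ≥ 1`. -/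
abbrev TPlus : Type _ := ⨁ n : {n : ℕ // 0 < n}, ⨂[k]^n.1 B

/-- `T(T(B)⁺)`. -/
abbrev TT : Type _ := TensorAlgebra k (TPlus k B)

/-- `S(T(B)⁺)`, the quotient of `T(T(B)⁺)` by the ideal generated by the commutators `ab - ba` of
elements of `T(B)⁺`. -/
abbrev ST : Type _ := SymmetricAlgebra k (TPlus k B)

/-- The inclusion of `Tⁿ(B)` into `T(B)⁺`, for `n ≥ 1`. -/
def incl (n : ℕ) (hn : 0 < n) : (⨂[k]^n B) →ₗ[k] TPlus k B :=
  DirectSum.lof k {n : ℕ // 0 < n} (fun n => ⨂[k]^n.1 B) ⟨n, hn⟩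

/-- The symmetrizing operator on `Tⁿ(B)`: it maps `(x₁, …, xₙ)` to the sum over all permutations
`σ` of `(x_{σ(1)}, …, x_{σ(n)})`. -/
def symmetrizer (n : ℕ) : (⨂[k]^n B) →ₗ[k] ⨂[k]^n B :=
  ∑ σ : Equiv.Perm (Fin n), (PiTensorProduct.reindex k (fun _ : Fin n => B) σ.symm).toLinearMap

/-- The symmetrizing operator `α` on `T(B)⁺`. -/
def alpha : TPlus k B →ₗ[k] TPlus k B :=
  DirectSum.lmap fun n : {n : ℕ // 0 < n} => symmetrizer k B n.1

/-- `S(B)⁺`, identified with the image of `α`. -/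
abbrev SPlus : Submodule k (TPlus k B) := LinearMap.range (alpha k B)

/-- The symmetric algebra `S(S(B)⁺)`. -/
abbrev SS : Type _ := SymmetricAlgebra k (SPlus k B)

/-- The canonical algebra map `S(S(B)⁺) → S(T(B)⁺)`, induced by the inclusion of `S(B)⁺` in
`T(B)⁺`. -/
def inclSS : SS k B →ₐ[k] ST k B :=
  SymmetricAlgebra.lift (SymmetricAlgebra.ι k (TPlus k B) ∘ₗ (SPlus k B).subtype)

/-- The map `a ↦ {a}` from `T(B)⁺` onto `S(B)⁺`. -/
def brace : TPlus k B →ₗ[k] SPlus k B := (alpha k B).rangeRestrict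

/-- The element `{x_j : j ∈ J}` of `S(B)⁺`, for a family of elements of `B` indexed by a nonempty
finite set `J`. It does not depend on the enumeration of `J` that is chosen here, see
`braceFamily_apply`. -/
def braceFamily (J : Type*) [Fintype J] [Nonempty J] :
    MultilinearMap k (fun _ : J => B) (SPlus k B) :=
  ((brace k B ∘ₗ incl k B (Fintype.card J) Fintype.card_pos).compMultilinearMap
    (PiTensorProduct.tprod k)).domDomCongr (Fintype.equivFin J).symm

theorem brace_incl_tprod_perm (n : ℕ) (hn : 0 < n) (x : Fin n → B) (τ : Equiv.Perm (Fin n)) :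
    brace k B (incl k B n hn (PiTensorProduct.tprod k fun i => x (τ i))) =
      brace k B (incl k B n hn (PiTensorProduct.tprod k x)) := by
  apply Subtype.ext
  change alpha k B (incl k B n hn _) = alpha k B (incl k B n hn _)
  simp only [alpha, incl, DirectSum.lmap_lof]
  congr 1
  simp only [symmetrizer, LinearMap.sum_apply, LinearEquiv.coe_coe, PiTensorProduct.reindex_tprod,
    Equiv.symm_symm]
  exact Equiv.sum_comp (Equiv.mulLeft τ)
    fun σ : Equiv.Perm (Fin n) => PiTensorProduct.tprod k fun i => x (σ i)

/-- `braceFamily` can be computed with any enumeration `e` of `J`. -/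
theorem braceFamily_apply (J : Type*) [Fintype J] [Nonempty J] (x : J → B)
    (e : Fin (Fintype.card J) ≃ J) :
    braceFamily k B J x =
      brace k B (incl k B (Fintype.card J) Fintype.card_pos
        (PiTensorProduct.tprod k fun i => x (e i))) := by
  have h := brace_incl_tprod_perm k B (Fintype.card J) Fintype.card_pos (fun i => x (e i))
    ((Fintype.equivFin J).symm.trans e.symm)
  simp only [Equiv.trans_apply, Equiv.apply_symm_apply] at h
  exact h

end TensorPart

section Coproduct

variable (k B : Type*) [Field k] [NonUnitalRing B] [Module k B]
  [IsScalarTower k B B] [SMulCommClass k B B]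

/-- `μ` on `Tⁿ(B)`, for `n ≥ 1`: it maps `(x₁, …, xₙ)` to `x₁ ⋯ xₙ`. The product is computed in
the unitization `k ⊕ B` of `B`; for `n ≥ 1` it lies in the summand `B`. -/
def mulFin (n : ℕ) : MultilinearMap k (fun _ : Fin n => B) B :=
  (Unitization.sndHom k k B).compMultilinearMap
    ((MultilinearMap.mkPiAlgebraFin k n (Unitization k B)).compLinearMap
      fun _ => Unitization.inrHom k k B)

/-- The restriction `a ↦ a|ρ`, from `Tⁿ(B)` to `T(T(B)⁺)`, for a composition `ρ` of `n`:
`(x₁, …, xₙ)` is mapped to `(x₁, …, x_{r₁})(x_{r₁+1}, …, x_{r₁+r₂}) ⋯ (…, xₙ)`. -/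
def restrict {n : ℕ} (ρ : Composition n) : (⨂[k]^n B) →ₗ[k] TT k B :=
  PiTensorProduct.lift <|
    ((MultilinearMap.mkPiAlgebraFin k ρ.length (TT k B)).compMultilinearMap fun i =>
      (TensorAlgebra.ι k ∘ₗ incl k B (ρ.blocksFun i) (ρ.one_le_blocksFun i)).compMultilinearMap
        (PiTensorProduct.tprod k : MultilinearMap k (fun _ : Fin (ρ.blocksFun i) => B) _)).domDomCongr
      ρ.blocksFinEquiv

/-- The contraction `a ↦ a/ρ`, from `Tⁿ(B)` to `T^{ℓ(ρ)}(B)`, for a composition `ρ` of `n`: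
`(x₁, …, xₙ)` is mapped to `(x₁ ⋯ x_{r₁}, x_{r₁+1} ⋯ x_{r₁+r₂}, …)`. -/
def contract {n : ℕ} (ρ : Composition n) : (⨂[k]^n B) →ₗ[k] ⨂[k]^ρ.length B :=
  PiTensorProduct.lift <|
    ((PiTensorProduct.tprod k :
        MultilinearMap k (fun _ : Fin ρ.length => B) _).compMultilinearMap fun i =>
      mulFin k B (ρ.blocksFun i)).domDomCongr ρ.blocksFinEquiv

/-- The contraction `a ↦ a/ρ`, as a map from `Tⁿ(B)`, `n ≥ 1`, to `T(T(B)⁺)`. -/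
def contractTT {n : ℕ} (hn : 0 < n) (ρ : Composition n) : (⨂[k]^n B) →ₗ[k] TT k B :=
  TensorAlgebra.ι k ∘ₗ incl k B ρ.length (ρ.length_pos_of_pos hn) ∘ₗ contract k B ρ

end Coproduct

section Coalg

variable (k B : Type*) [Field k] [NonUnitalRing B] [Module k B] [Coalgebra k B]

/-- The free coproduct `δ` on `Tⁿ(B)`: it maps `(x¹, …, xⁿ)` to
`∑ (x¹₍₁₎, …, xⁿ₍₁₎) ⊗ (x¹₍₂₎, …, xⁿ₍₂₎)`. It is defined by recursion on `n`, through the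
isomorphism of `T^{n+1}(B)` with `Tⁿ(B) ⊗ B`. -/
def freeComul : (n : ℕ) → (⨂[k]^n B) →ₗ[k] (⨂[k]^n B) ⊗[k] (⨂[k]^n B)
  | 0 => (TensorProduct.mk k (⨂[k]^0 B) (⨂[k]^0 B)).flip (PiTensorProduct.tprod k Fin.elim0)
  | n + 1 =>
    TensorProduct.map (TensorPower.mulEquiv (n := n) (m := 1)).toLinearMap
        (TensorPower.mulEquiv (n := n) (m := 1)).toLinearMap ∘ₗ
      (TensorProduct.tensorTensorTensorComm k (⨂[k]^n B) (⨂[k]^n B)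
        (⨂[k]^1 B) (⨂[k]^1 B)).toLinearMap ∘ₗ
      TensorProduct.map (freeComul n)
        (TensorProduct.map
            (PiTensorProduct.subsingletonEquiv (R := k) (s := fun _ : Fin 1 => B) 0).symm.toLinearMap
            (PiTensorProduct.subsingletonEquiv (R := k) (s := fun _ : Fin 1 => B) 0).symm.toLinearMap
          ∘ₗ Coalgebra.comul ∘ₗ
          (PiTensorProduct.subsingletonEquiv (R := k) (s := fun _ : Fin 1 => B) 0).toLinearMap) ∘ₗ
      (TensorPower.mulEquiv (R := k) (M := B) (n := n) (m := 1)).symm.toLinearMap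

/-- The free counit on `Tⁿ(B)`: it maps `(x¹, …, xⁿ)` to `ε(x¹) ⋯ ε(xⁿ)`. -/
def freeCounit (n : ℕ) : (⨂[k]^n B) →ₗ[k] k :=
  PiTensorProduct.lift <|
    (MultilinearMap.mkPiAlgebra k (Fin n) k).compLinearMap fun _ => Coalgebra.counit

/-- The counit of the renormalization bialgebra `T(T(B)⁺)`: the algebra map with `(x) ↦ ε(x)` for
`x ∈ B` and `(x₁, …, xₙ) ↦ 0` for `n > 1`. -/
def renormCounit : TT k B →ₐ[k] k :=
  TensorAlgebra.lift k <| DirectSum.toModule k {n : ℕ // 0 < n} k fun n =>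
    if n.1 = 1 then freeCounit k B n.1 else 0

/-- The renormalization coproduct on `T(T(B)⁺)`: the algebra map with
`Δ a = ∑_ρ a₍₁₎|ρ ⊗ a₍₂₎/ρ` for `a ∈ Tⁿ(B)`, `n ≥ 1`, where `ρ` runs over the compositions
of `n`. -/
def renormComul [IsScalarTower k B B] [SMulCommClass k B B] : TT k B →ₐ[k] TT k B ⊗[k] TT k B :=
  TensorAlgebra.lift k <| DirectSum.toModule k {n : ℕ // 0 < n} (TT k B ⊗[k] TT k B) fun n =>
    ∑ ρ : Composition n.1,
      TensorProduct.map (restrict k B ρ) (contractTT k B n.2 ρ) ∘ₗ freeComul k B n.1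

end Coalg

section Partitions

/-- A partition of the set `{1, …, n}`: a set of nonempty, pairwise disjoint subsets (the blocks,
`π.parts`) with union `{1, …, n}`. -/
abbrev SetPartition (n : ℕ) : Type := Finpartition (Finset.univ : Finset (Fin n))

instance SetPartition.nonempty_block {n : ℕ} (π : SetPartition n) (P : π.parts) :
    Nonempty P.1 :=
  (π.nonempty_of_mem_parts P.2).to_subtype

theorem SetPartition.nonempty_parts {n : ℕ} (hn : 0 < n) (π : SetPartition n) :
    Nonempty π.parts :=
  ⟨⟨π.part ⟨0, hn⟩, π.part_mem.2 (Finset.mem_univ _)⟩⟩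

/-- The union of the blocks of `π` is `{1, …, n}`: the pair of a block `P` and `i ∈ P` corresponds
to `i`. -/
def SetPartition.blocksEquiv {n : ℕ} (π : SetPartition n) :
    (Σ P : π.parts, (P.1 : Finset (Fin n))) ≃ Fin n :=
  π.equivSigmaParts.symm.trans (Equiv.subtypeUnivEquiv Finset.mem_univ)

variable (k B : Type*) [Field k] [NonUnitalCommRing B] [Module k B]

/-- The restriction `a ↦ a|π = ∏_{P ∈ π} {a|P}`, from `Tⁿ(B)` to `S(S(B)⁺)`, where
`{a|P} = {x_i : i ∈ P}` for `a = (x₁, …, xₙ)`. -/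
def restrictSet {n : ℕ} (π : SetPartition n) : (⨂[k]^n B) →ₗ[k] SS k B :=
  PiTensorProduct.lift <|
    ((MultilinearMap.mkPiAlgebra k π.parts (SS k B)).compMultilinearMap fun P =>
      (SymmetricAlgebra.ι k (SPlus k B)).compMultilinearMap (braceFamily k B P.1)).domDomCongr
      π.blocksEquiv

variable [IsScalarTower k B B] [SMulCommClass k B B]

/-- The product in a commutative `B` of a family of elements indexed by a nonempty finite set `J`.
It is computed in the unitization `k ⊕ B` of `B`, and lies in the summand `B`. -/
def mulFamily (J : Type*) [Fintype J] : MultilinearMap k (fun _ : J => B) B :=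
  (Unitization.sndHom k k B).compMultilinearMap
    ((MultilinearMap.mkPiAlgebra k J (Unitization k B)).compLinearMap
      fun _ => Unitization.inrHom k k B)

/-- The contraction `a ↦ a/π`, from `Tⁿ(B)`, `n ≥ 1`, to `S(B)⁺`, for a commutative `B`:
`(x₁, …, xₙ)` is mapped to `{∏_{i ∈ P} x_i : P ∈ π}`. -/
def contractSet {n : ℕ} (hn : 0 < n) (π : SetPartition n) : (⨂[k]^n B) →ₗ[k] SPlus k B :=
  haveI := π.nonempty_parts hn
  PiTensorProduct.lift <|
    ((braceFamily k B π.parts).compMultilinearMap fun P => mulFamily k B P.1).domDomCongr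
      π.blocksEquiv

/-- The contraction `a ↦ a/π`, as a map from `Tⁿ(B)`, `n ≥ 1`, to `S(S(B)⁺)`. -/
def contractSetSS {n : ℕ} (hn : 0 < n) (π : SetPartition n) : (⨂[k]^n B) →ₗ[k] SS k B :=
  SymmetricAlgebra.ι k (SPlus k B) ∘ₗ contractSet k B hn π

end Partitions

end

end Renormalization

open Renormalization

/-! The coproduct on `Tⁿ(B)` factors as the coproduct of `B` applied to each letter, followed by
`pairComul`, the purely combinatorial map `(a₁ ⊗ b₁, …, aₙ ⊗ bₙ) ↦ ∑_ρ a|ρ ⊗ b/ρ`. Since `Δ` is an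
algebra map and the coproduct of `B` is multiplicative, the letterwise coproduct can be pulled out
of `(Δ ⊗ id)Δ` and `(id ⊗ Δ)Δ` as well (`comp_blockProd`, `map_contract`). Coassociativity of `B`
then reduces the claim to words of pure tensors `a ⊗ b ⊗ c`. There both sides are the same sum over
bracketings of the word into lists of lists: cutting a word and then each piece is the same as
cutting it and then the list of its pieces (`sum_splits_choices`). For the counit laws only the
finest or the coarsest composition survives.

The structure descends to `S(T(B)⁺)` because it is prescribed on generators and the targets are
commutative. A linear retraction of `T(B)⁺` onto `S(B)⁺` induces an algebra retraction of `inclSS`;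
this gives injectivity, also on tensor powers, so the bialgebra axioms can be tested in the larger
algebra.

For the partition formula, `Δ{a}` is a sum over pairs of a permutation and a composition, that is,
over orderings of `{1, …, n}` cut into pieces. Such data amount to a set partition, an ordering of
its blocks and an ordering inside each block (`sum_listings_splits`). The inner orderings produce
the braces of `a|π`, the ordering of the blocks produces the brace of `a/π`, and commutativity of
`S(T(B)⁺)` and of `B` makes the two kinds independent. -/

namespace Renormalization

/-! ### Combinatorics of cutting lists into nonempty pieces -/

section Lists

variable {α : Type*}

/-- The ways to cut a list into nonempty pieces. -/
noncomputable def splits (l : List α) : Finset (List (List α)) :=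
  open Classical in
  (Finset.univ : Finset (Composition l.length)).image fun c => l.splitWrtComposition c

theorem mem_splits {l : List α} {L : List (List α)} :
    L ∈ splits l ↔ L.flatten = l ∧ [] ∉ L := by
  simp only [splits, Finset.mem_image, Finset.mem_univ, true_and]
  constructor
  · rintro ⟨c, rfl⟩
    refine ⟨List.flatten_splitWrtComposition l c, fun h => ?_⟩
    simpa using List.length_pos_of_mem_splitWrtComposition h
  · rintro ⟨rfl, h⟩
    refine ⟨⟨L.map List.length, ?_, by rw [List.length_flatten]⟩, ?_⟩
    · intro i hi
      obtain ⟨a, ha, rfl⟩ := List.mem_map.1 hi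
      exact List.length_pos_iff.2 fun h' => h (h' ▸ ha)
    · exact List.splitWrtComposition_flatten L _ rfl

theorem sum_splits {M : Type*} [AddCommMonoid M] {n : ℕ} (l : List α) (hl : l.length = n)
    (F : List (List α) → M) :
    ∑ L ∈ splits l, F L = ∑ c : Composition n, F (l.splitWrtComposition c) := by
  classical
  subst hl
  unfold splits
  rw [Finset.sum_image]
  intro c _ c' _ h
  apply Composition.ext
  rw [← List.map_length_splitWrtComposition l c, ← List.map_length_splitWrtComposition l c']
  exact congrArg _ h

theorem splitWrtComposition_ofFn {n : ℕ} (y : Fin n → α) (c : Composition n) :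
    (List.ofFn y).splitWrtComposition c =
      List.ofFn fun i => List.ofFn fun j => y (c.embedding i j) := by
  apply List.ext_getElem
  · simp
  · intro i h1 h2
    rw [List.getElem_splitWrtComposition]
    simp only [List.getElem_ofFn]
    have hi : i < c.length := by simpa using h1
    have hs : c.sizeUpTo (i + 1) = c.sizeUpTo i + c.blocksFun ⟨i, hi⟩ :=
      c.sizeUpTo_succ hi
    have hle := c.sizeUpTo_le (i + 1)
    apply List.ext_getElem
    · simp
      omega
    · intro j h3 h4
      simp only [List.getElem_drop, List.getElem_take, List.getElem_ofFn]
      rfl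

open Classical in
/-- The ways to choose an element of `S a` for each entry `a` of a list. -/
noncomputable def choices {β : Type*} (S : α → Finset β) : List α → Finset (List β)
  | [] => {[]}
  | a :: l => (S a ×ˢ choices S l).image fun p => p.1 :: p.2

theorem mem_choices {β : Type*} {S : α → Finset β} {l : List α} {m : List β} :
    m ∈ choices S l ↔ List.Forall₂ (fun a b => b ∈ S a) l m := by
  induction l generalizing m with
  | nil => simp [choices]
  | cons a l ih =>
    simp only [choices, Finset.mem_image, Finset.mem_product, Prod.exists, ih,
      List.forall₂_cons_left_iff]
    constructor
    · rintro ⟨b, m, ⟨h1, h2⟩, rfl⟩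
      exact ⟨b, m, h1, h2, rfl⟩
    · rintro ⟨b, m, h1, h2, rfl⟩
      exact ⟨b, m, ⟨h1, h2⟩, rfl⟩

/-- When each `S a` is a fibre of `g` cut down by `p`, the list `l` can be recovered from the choice
`m` as `m.map g`. This is what makes the reindexings of double sums below invertible. -/
theorem mem_choices_iff_map_eq {β : Type*} {S : α → Finset β} {g : β → α} {p : β → Prop}
    (h : ∀ a b, b ∈ S a ↔ g b = a ∧ p b) {l : List α} {m : List β} :
    m ∈ choices S l ↔ m.map g = l ∧ ∀ b ∈ m, p b := by
  rw [mem_choices]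
  induction m generalizing l with
  | nil => simp [eq_comm]
  | cons b m ih =>
    simp only [List.forall₂_cons_right_iff, ih, h _ b, List.map_cons, List.mem_cons,
      forall_eq_or_imp]
    constructor
    · rintro ⟨a, l, ⟨rfl, h1⟩, ⟨rfl, h2⟩, rfl⟩
      exact ⟨rfl, h1, h2⟩
    · rintro ⟨rfl, h1, h2⟩
      exact ⟨_, _, ⟨rfl, h1⟩, ⟨rfl, h2⟩, rfl⟩

theorem prod_map_sum {β A : Type*} [Semiring A] (S : α → Finset β) (G : β → A) (l : List α) :
    (l.map fun a => ∑ b ∈ S a, G b).prod = ∑ m ∈ choices S l, (m.map G).prod := by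
  induction l with
  | nil => simp [choices]
  | cons a l ih =>
    classical
    rw [List.map_cons, List.prod_cons, ih, choices, Finset.sum_image, Finset.sum_product,
      Finset.sum_mul_sum]
    · simp
    · rintro ⟨a, b⟩ _ ⟨c, d⟩ _ h
      simpa using h

theorem mem_choices_splits {L : List (List α)} {N : List (List (List α))} :
    N ∈ choices splits L ↔ N.map List.flatten = L ∧ ∀ M ∈ N, [] ∉ M :=
  mem_choices_iff_map_eq fun _ _ => mem_splits

/-- Cutting a list and then each of its pieces amounts to cutting the list and then the list of
its pieces. -/
theorem sum_splits_choices {M : Type*} [AddCommMonoid M] (l : List α)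
    (F : List (List (List α)) → M) :
    ∑ L ∈ splits l, ∑ N ∈ choices splits L, F N = ∑ L ∈ splits l, ∑ N ∈ splits L, F N := by
  rw [Finset.sum_sigma', Finset.sum_sigma']
  -- In both sums `N` determines `L`: it is `N.map flatten` on the left and `N.flatten` on the
  -- right. The conditions on `N` agree, namely that it flattens twice to `l` and has no empty list
  -- at either level.
  refine Finset.sum_bij' (fun p _ => ⟨p.2.flatten, p.2⟩) (fun p _ => ⟨p.2.map List.flatten, p.2⟩)
    ?_ ?_ ?_ ?_ ?_
  · rintro ⟨L, N⟩ h
    simp only [Finset.mem_sigma, mem_splits, mem_choices_splits] at h ⊢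
    obtain ⟨⟨rfl, h1⟩, rfl, h2⟩ := h
    refine ⟨⟨?_, ?_⟩, trivial, ?_⟩
    · rw [List.flatten_flatten]
    · rw [List.mem_flatten]
      rintro ⟨M, hM, h⟩
      exact h2 M hM h
    · exact fun h => h1 (List.mem_map.2 ⟨[], h, rfl⟩)
  · rintro ⟨L, N⟩ h
    simp only [Finset.mem_sigma, mem_splits, mem_choices_splits] at h ⊢
    obtain ⟨⟨rfl, h1⟩, rfl, h2⟩ := h
    have h3 : ∀ M ∈ N, [] ∉ M := fun M hM h => h1 (List.mem_flatten.2 ⟨M, hM, h⟩)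
    refine ⟨⟨?_, ?_⟩, trivial, h3⟩
    · rw [List.flatten_flatten]
    · intro h
      obtain ⟨M, hM, h⟩ := List.mem_map.1 h
      cases M with
      | nil => exact h2 hM
      | cons a M =>
        simp only [List.flatten_cons, List.append_eq_nil_iff] at h
        exact h3 _ hM (by simp [h.1])
  · rintro ⟨L, N⟩ h
    simp only [Finset.mem_sigma, mem_splits, mem_choices_splits] at h ⊢
    simp [h.2.1]
  · rintro ⟨L, N⟩ h
    simp only [Finset.mem_sigma, mem_splits] at h ⊢
    simp [h.2.1]
  · rintro ⟨L, N⟩ h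
    rfl

end Lists

end Renormalization

/-! ### Multilinear maps and tensor powers of tensor products -/

namespace Renormalization

section Multilinear

variable {k : Type*} [CommSemiring k]

theorem multilinear_ext_of_span {ι V M : Type*} [Finite ι] [AddCommMonoid V] [Module k V]
    [AddCommMonoid M] [Module k M] {S : Set V} (hS : Submodule.span k S = ⊤)
    {f g : MultilinearMap k (fun _ : ι => V) M} (h : ∀ x, (∀ i, x i ∈ S) → f x = g x) : f = g := by
  classical
  cases nonempty_fintype ι
  -- Slots in `s` are arbitrary, the others lie in `S`. Freeing one more slot is a span induction in
  -- that slot alone.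
  suffices H : ∀ s : Finset ι, ∀ x, (∀ i ∉ s, x i ∈ S) → f x = g x from
    MultilinearMap.ext fun x => H Finset.univ x fun i hi => absurd (Finset.mem_univ i) hi
  intro s
  induction s using Finset.induction with
  | empty => exact fun x hx => h x fun i => hx i (Finset.notMem_empty i)
  | insert a s ha ih =>
    intro x hx
    rw [← Function.update_eq_self a x]
    have hxa : x a ∈ Submodule.span k S := hS ▸ Submodule.mem_top
    generalize x a = v at hxa
    induction hxa using Submodule.span_induction with
    | mem v hv =>
      refine ih _ fun i hi => ?_
      by_cases hia : i = a
      · subst hia; simpa using hv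
      · simpa [hia] using hx i (by simp [hia, hi])
    | zero => simp only [MultilinearMap.map_update_zero]
    | add v w _ _ hv hw => simp only [MultilinearMap.map_update_add, hv, hw]
    | smul c v _ hv => simp only [MultilinearMap.map_update_smul, hv]

variable {U V W M : Type*} [AddCommMonoid U] [Module k U] [AddCommMonoid V] [Module k V]
  [AddCommMonoid W] [Module k W] [AddCommMonoid M] [Module k M]

theorem tensorPower_ext_tmul {n : ℕ} {f g : (⨂[k]^n (V ⊗[k] W)) →ₗ[k] M}
    (h : ∀ (a : Fin n → V) (b : Fin n → W), f (PiTensorProduct.tprod k fun i => a i ⊗ₜ b i) =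
      g (PiTensorProduct.tprod k fun i => a i ⊗ₜ b i)) : f = g := by
  apply PiTensorProduct.ext
  apply multilinear_ext_of_span (TensorProduct.span_tmul_eq_top k V W)
  intro x hx
  choose a b hab using hx
  obtain rfl : (fun i => a i ⊗ₜ[k] b i) = x := funext hab
  exact h a b

theorem span_tmul_tmul_eq_top :
    Submodule.span k {t : (U ⊗[k] V) ⊗[k] W | ∃ a b c, (a ⊗ₜ b) ⊗ₜ c = t} = ⊤ := by
  rw [eq_top_iff]
  rintro t -
  induction t with
  | zero => exact zero_mem _
  | add x y hx hy => exact add_mem hx hy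
  | tmul x c =>
    induction x with
    | zero => simp
    | add x y hx hy => rw [TensorProduct.add_tmul]; exact add_mem hx hy
    | tmul a b => exact Submodule.subset_span ⟨a, b, c, rfl⟩

theorem tensorPower_ext_tmul_tmul {n : ℕ} {f g : (⨂[k]^n ((U ⊗[k] V) ⊗[k] W)) →ₗ[k] M}
    (h : ∀ (a : Fin n → U) (b : Fin n → V) (c : Fin n → W),
      f (PiTensorProduct.tprod k fun i => (a i ⊗ₜ b i) ⊗ₜ c i) =
      g (PiTensorProduct.tprod k fun i => (a i ⊗ₜ b i) ⊗ₜ c i)) : f = g := by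
  apply PiTensorProduct.ext
  apply multilinear_ext_of_span span_tmul_tmul_eq_top
  intro x hx
  choose a b c hab using hx
  obtain rfl : (fun i => (a i ⊗ₜ[k] b i) ⊗ₜ[k] c i) = x := funext hab
  exact h a b c

theorem mulEquiv_symm_tprod (n : ℕ) (x : Fin (n + 1) → V) :
    (TensorPower.mulEquiv (R := k) (M := V) (n := n) (m := 1)).symm (PiTensorProduct.tprod k x) =
      PiTensorProduct.tprod k (fun i : Fin n => x i.castSucc) ⊗ₜ
        PiTensorProduct.tprod k (fun _ : Fin 1 => x (Fin.last n)) := by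
  rw [LinearEquiv.symm_apply_eq, ← TensorPower.gMul_def, TensorPower.tprod_mul_tprod]
  congr 1
  ext i
  refine Fin.lastCases ?_ (fun i => ?_) i
  · rw [Fin.append_right_eq_snoc]; simp
  · rw [Fin.append_right_eq_snoc]; simp

theorem mulEquiv_tmul_tprod (n : ℕ) (x : Fin (n + 1) → V) :
    TensorPower.mulEquiv (PiTensorProduct.tprod k (fun i : Fin n => x i.castSucc) ⊗ₜ[k]
      PiTensorProduct.tprod k (fun _ : Fin 1 => x (Fin.last n))) = PiTensorProduct.tprod k x := by
  rw [← mulEquiv_symm_tprod, LinearEquiv.apply_symm_apply]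

/-- The map `Tⁿ(V ⊗ W) → Tⁿ(V) ⊗ Tⁿ(W)`. -/
noncomputable def unzip (k V W : Type*) [CommSemiring k] [AddCommMonoid V] [Module k V]
    [AddCommMonoid W] [Module k W] : (n : ℕ) → (⨂[k]^n (V ⊗[k] W)) →ₗ[k] (⨂[k]^n V) ⊗[k] (⨂[k]^n W)
  | 0 => PiTensorProduct.lift (MultilinearMap.constOfIsEmpty k _
      (PiTensorProduct.tprod k Fin.elim0 ⊗ₜ PiTensorProduct.tprod k Fin.elim0))
  | n + 1 =>
    TensorProduct.map (TensorPower.mulEquiv (n := n) (m := 1)).toLinearMap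
        (TensorPower.mulEquiv (n := n) (m := 1)).toLinearMap ∘ₗ
      (TensorProduct.tensorTensorTensorComm k (⨂[k]^n V) (⨂[k]^n W)
        (⨂[k]^1 V) (⨂[k]^1 W)).toLinearMap ∘ₗ
      TensorProduct.map (unzip k V W n)
        (TensorProduct.map
            (PiTensorProduct.subsingletonEquiv (R := k) (s := fun _ : Fin 1 => V) 0).symm.toLinearMap
            (PiTensorProduct.subsingletonEquiv (R := k) (s := fun _ : Fin 1 => W) 0).symm.toLinearMap
          ∘ₗ
          (PiTensorProduct.subsingletonEquiv (R := k) (s := fun _ : Fin 1 => V ⊗[k] W) 0).toLinearMap) ∘ₗ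
      (TensorPower.mulEquiv (R := k) (M := V ⊗[k] W) (n := n) (m := 1)).symm.toLinearMap

@[simp]
theorem unzip_tprod (n : ℕ) (a : Fin n → V) (b : Fin n → W) :
    unzip k V W n (PiTensorProduct.tprod k fun i => a i ⊗ₜ b i) =
      PiTensorProduct.tprod k a ⊗ₜ PiTensorProduct.tprod k b := by
  induction n with
  | zero =>
    simp only [unzip, PiTensorProduct.lift.tprod, MultilinearMap.constOfIsEmpty_apply]
    rw [Subsingleton.elim a Fin.elim0, Subsingleton.elim b Fin.elim0]
    rfl
  | succ n ih =>
    simp only [unzip, LinearMap.comp_apply, LinearEquiv.coe_coe, mulEquiv_symm_tprod,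
      TensorProduct.map_tmul, ih, PiTensorProduct.subsingletonEquiv_apply_tprod,
      TensorProduct.tensorTensorTensorComm_tmul,
      PiTensorProduct.subsingletonEquiv_symm_apply']
    rw [mulEquiv_tmul_tprod, mulEquiv_tmul_tprod]

end Multilinear

/-- `unzip` follows the recursion of `freeComul` with the coproduct of `B` left out, so the two
unfold in parallel. -/
theorem freeComul_tprod (k B : Type*) [Field k] [NonUnitalRing B] [Module k B] [Coalgebra k B]
    (n : ℕ) (x : Fin n → B) :
    freeComul k B n (PiTensorProduct.tprod k x) =
      unzip k B B n (PiTensorProduct.tprod k fun i => Coalgebra.comul (x i)) := by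
  induction n with
  | zero =>
    simp only [freeComul, unzip, PiTensorProduct.lift.tprod, MultilinearMap.constOfIsEmpty_apply,
      LinearMap.flip_apply, TensorProduct.mk_apply]
    congr 2 ; exact Subsingleton.elim _ _
  | succ n ih =>
    simp only [freeComul, unzip, LinearMap.comp_apply, LinearEquiv.coe_coe, mulEquiv_symm_tprod,
      TensorProduct.map_tmul, ih, PiTensorProduct.subsingletonEquiv_apply_tprod]

end Renormalization

/-! ### Words: products over blocks and products of letters -/

namespace Renormalization

noncomputable section

section Words

variable {k V : Type*} [CommSemiring k] [AddCommMonoid V] [Module k V]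

/-- The values of the linear maps `φ n` on words; the empty word is sent to `0`. -/
def wordMap {M : Type*} [AddCommMonoid M] [Module k M]
    (φ : ∀ n : ℕ, 0 < n → (⨂[k]^n V) →ₗ[k] M) (l : List V) : M :=
  if h : 0 < l.length then φ l.length h (PiTensorProduct.tprod k l.get) else 0

theorem wordMap_ofFn {M : Type*} [AddCommMonoid M] [Module k M]
    (φ : ∀ n : ℕ, 0 < n → (⨂[k]^n V) →ₗ[k] M) {n : ℕ} (hn : 0 < n) (x : Fin n → V) :
    wordMap φ (List.ofFn x) = φ n hn (PiTensorProduct.tprod k x) := by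
  -- The length of `List.ofFn x` is `n` only up to a propositional equality, so the tuples are
  -- compared in a sigma type.
  have key : ∀ (m : ℕ) (hm : 0 < m) (y : Fin m → V),
      (⟨m, y⟩ : Σ n, Fin n → V) = ⟨n, x⟩ →
      φ m hm (PiTensorProduct.tprod k y) = φ n hn (PiTensorProduct.tprod k x) := by
    rintro m hm y h
    cases h
    rfl
  rw [wordMap, dif_pos (by simpa using hn)]
  exact key _ _ _ (List.equivSigmaTuple.apply_symm_apply (⟨n, x⟩ : Σ n, Fin n → V))

/-- The map `(x₁, …, xₙ) ↦ φ(x₁, …, x_{r₁}) φ(x_{r₁+1}, …, x_{r₁+r₂}) ⋯`. -/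
def blockProd {A : Type*} [Semiring A] [Algebra k A]
    (φ : ∀ n : ℕ, 0 < n → (⨂[k]^n V) →ₗ[k] A) {n : ℕ} (ρ : Composition n) : (⨂[k]^n V) →ₗ[k] A :=
  PiTensorProduct.lift <|
    ((MultilinearMap.mkPiAlgebraFin k ρ.length A).compMultilinearMap fun i =>
      (φ (ρ.blocksFun i) (ρ.one_le_blocksFun i)).compMultilinearMap
        (PiTensorProduct.tprod k : MultilinearMap k (fun _ : Fin (ρ.blocksFun i) => V) _)).domDomCongr
      ρ.blocksFinEquiv

theorem blockProd_tprod {A : Type*} [Semiring A] [Algebra k A]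
    (φ : ∀ n : ℕ, 0 < n → (⨂[k]^n V) →ₗ[k] A) {n : ℕ} (ρ : Composition n) (x : Fin n → V) :
    blockProd φ ρ (PiTensorProduct.tprod k x) =
      (List.ofFn fun i => φ (ρ.blocksFun i) (ρ.one_le_blocksFun i)
        (PiTensorProduct.tprod k fun j => x (ρ.embedding i j))).prod := by
  rw [blockProd, PiTensorProduct.lift.tprod]
  rfl

/-- Replaces tuples whose type depends on `ρ` by lists. Cutting the list of indices `y`, rather than
of values, lets several families be read along the same cut. -/
theorem blockProd_tprod_list {α A : Type*} [Semiring A] [Algebra k A]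
    (φ : ∀ n : ℕ, 0 < n → (⨂[k]^n V) →ₗ[k] A) {n : ℕ} (ρ : Composition n)
    (x : α → V) (y : Fin n → α) :
    blockProd φ ρ (PiTensorProduct.tprod k fun i => x (y i)) =
      (((List.ofFn y).splitWrtComposition ρ).map fun l => wordMap φ (l.map x)).prod := by
  rw [blockProd_tprod, splitWrtComposition_ofFn, List.map_ofFn]
  congr 2
  ext i
  simp only [Function.comp, List.map_ofFn]
  rw [wordMap_ofFn φ (ρ.one_le_blocksFun i)]
  rfl

/-- Naturality of the block product. With `f` the coproduct of `T(T(B)⁺)` and `g` that of `B`, it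
pulls the letterwise coproduct out of `Δ(a|ρ)`. -/
theorem comp_blockProd {V' A A' : Type*} [AddCommMonoid V'] [Module k V'] [Semiring A] [Algebra k A]
    [Semiring A'] [Algebra k A']
    (φ : ∀ n : ℕ, 0 < n → (⨂[k]^n V) →ₗ[k] A) (φ' : ∀ n : ℕ, 0 < n → (⨂[k]^n V') →ₗ[k] A')
    (f : A →ₐ[k] A') (g : V →ₗ[k] V')
    (h : ∀ (n : ℕ) (hn : 0 < n) x, f (φ n hn x) = φ' n hn (PiTensorProduct.map (fun _ => g) x))
    {n : ℕ} (ρ : Composition n) (x : ⨂[k]^n V) :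
    f (blockProd φ ρ x) = blockProd φ' ρ (PiTensorProduct.map (fun _ => g) x) := by
  suffices H : f.toLinearMap ∘ₗ blockProd φ ρ =
      blockProd φ' ρ ∘ₗ PiTensorProduct.map (fun _ => g) from LinearMap.congr_fun H x
  apply PiTensorProduct.ext
  ext x
  simp only [LinearMap.compMultilinearMap_apply, LinearMap.comp_apply, PiTensorProduct.map_tprod,
    blockProd_tprod, AlgHom.toLinearMap_apply, map_list_prod, List.map_ofFn]
  congr 2
  ext i
  simp [h]

end Words

section Mul

variable (k : Type*) {V : Type*} [Field k] [NonUnitalRing V] [Module k V]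

/-- The product of a nonempty word; the empty word is sent to `0`. -/
def mulList (l : List V) : V :=
  ((l.map fun x => (Unitization.inr x : Unitization k V)).prod).snd

theorem inr_mulList {l : List V} (hl : l ≠ []) :
    (Unitization.inr (mulList k l) : Unitization k V) =
      (l.map fun x => (Unitization.inr x : Unitization k V)).prod := by
  induction l with
  | nil => exact absurd rfl hl
  | cons x l ih =>
    by_cases h : l = []
    · subst h; simp [mulList]
    · unfold mulList
      rw [List.map_cons, List.prod_cons, ← ih h, ← Unitization.inr_mul, Unitization.snd_inr]

@[simp]
theorem mulList_singleton (x : V) : mulList k [x] = x := by simp [mulList]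

theorem mulList_cons (x : V) {l : List V} (hl : l ≠ []) :
    mulList k (x :: l) = x * mulList k l := by
  apply Unitization.inr_injective (R := k)
  rw [inr_mulList k (by simp), List.map_cons, List.prod_cons, ← inr_mulList k hl,
    ← Unitization.inr_mul]

theorem map_mulList {V' : Type*} [NonUnitalRing V'] [Module k V'] (f : V → V') (hf : ∀ x y, f (x * y) = f x * f y)
    {l : List V} (hl : l ≠ []) :
    f (mulList k l) = mulList k (l.map f) := by
  induction l with
  | nil => exact absurd rfl hl
  | cons x l ih =>
    by_cases h : l = []
    · subst h; simp
    · rw [mulList_cons k x h, hf, ih h, List.map_cons, mulList_cons k _ (by simpa using h)]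

variable [IsScalarTower k V V] [SMulCommClass k V V]

/-- General associativity. An empty piece has to be excluded because `mulList` gives it the default
value `0`, which does not act as a unit. -/
theorem mulList_flatten {L : List (List V)} (hL : [] ∉ L) (hL' : L ≠ []) :
    mulList k L.flatten = mulList k (L.map (mulList k)) := by
  have h : L.flatten ≠ [] := by
    intro h
    obtain ⟨l, L, rfl⟩ := List.exists_cons_of_ne_nil hL'
    simp only [List.flatten_cons, List.append_eq_nil_iff] at h
    exact hL (by simp [h.1])
  apply Unitization.inr_injective (R := k)
  rw [inr_mulList k h, inr_mulList k (by simpa using hL'), List.map_flatten, List.prod_flatten,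
    List.map_map, List.map_map]
  congr 1
  refine List.map_congr_left fun l hl => ?_
  exact (inr_mulList k fun h => hL (h ▸ hl)).symm

theorem mulFin_apply (n : ℕ) (x : Fin n → V) : mulFin k V n x = mulList k (List.ofFn x) := by
  simp only [mulFin, mulList, List.map_ofFn]
  rfl

theorem mulList_tmul {α W : Type*} [NonUnitalRing W] [Module k W]
    [IsScalarTower k W W] [SMulCommClass k W W] (f : α → V) (g : α → W)
    {l : List α} (hl : l ≠ []) :
    mulList k (l.map fun i => f i ⊗ₜ[k] g i) =
      mulList k (l.map f) ⊗ₜ mulList k (l.map g) := by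
  induction l with
  | nil => exact absurd rfl hl
  | cons x l ih =>
    by_cases h : l = []
    · subst h; simp
    · simp only [List.map_cons]
      rw [mulList_cons k _ (by simpa using h), mulList_cons k _ (by simpa using h),
        mulList_cons k _ (by simpa using h), ih h, Algebra.TensorProduct.tmul_mul_tmul]

theorem contract_tprod {n : ℕ} (ρ : Composition n) (x : Fin n → V) :
    contract k V ρ (PiTensorProduct.tprod k x) = PiTensorProduct.tprod k fun i =>
      mulList k (List.ofFn fun j => x (ρ.embedding i j)) := by
  rw [contract, PiTensorProduct.lift.tprod]
  simp only [← mulFin_apply]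
  rfl

theorem map_contract_tprod_list {α M : Type*} [AddCommMonoid M] [Module k M]
    (φ : ∀ n : ℕ, 0 < n → (⨂[k]^n V) →ₗ[k] M) {n : ℕ} (hn : 0 < n) (ρ : Composition n)
    (x : α → V) (y : Fin n → α) :
    φ ρ.length (ρ.length_pos_of_pos hn)
        (contract k V ρ (PiTensorProduct.tprod k fun i => x (y i))) =
      wordMap φ (((List.ofFn y).splitWrtComposition ρ).map fun l => mulList k (l.map x)) := by
  rw [contract_tprod, splitWrtComposition_ofFn, List.map_ofFn,
    wordMap_ofFn φ (ρ.length_pos_of_pos hn)]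
  congr 2
  ext i
  simp only [Function.comp, List.map_ofFn]
  rfl

/-- With `f` the coproduct of `B`, this is where its multiplicativity enters coassociativity. -/
theorem map_contract {V' : Type*} [NonUnitalRing V'] [Module k V']
    [IsScalarTower k V' V'] [SMulCommClass k V' V'] (f : V →ₗ[k] V')
    (hf : ∀ x y, f (x * y) = f x * f y) {n : ℕ} (ρ : Composition n) (x : ⨂[k]^n V) :
    PiTensorProduct.map (fun _ => f) (contract k V ρ x) =
      contract k V' ρ (PiTensorProduct.map (fun _ => f) x) := by
  suffices H : PiTensorProduct.map (fun _ => f) ∘ₗ contract k V ρ =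
      contract k V' ρ ∘ₗ PiTensorProduct.map (fun _ => f) from LinearMap.congr_fun H x
  apply PiTensorProduct.ext
  ext x
  simp only [LinearMap.compMultilinearMap_apply, LinearMap.comp_apply, PiTensorProduct.map_tprod,
    contract_tprod]
  congr 1
  ext i
  rw [map_mulList k f hf, List.map_ofFn]
  · rfl
  · have := ρ.one_le_blocksFun i
    rw [Ne, List.ofFn_eq_nil_iff]
    omega

end Mul

end

end Renormalization

/-! ### The coproduct on letters and its coassociativity -/

namespace Renormalization

noncomputable section

section Letters

variable (k B : Type*) [Field k] [NonUnitalRing B] [Module k B]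

/-- The inclusion of `Tⁿ(B)` into `T(T(B)⁺)`, for `n ≥ 1`. -/
def letter (n : ℕ) (hn : 0 < n) : (⨂[k]^n B) →ₗ[k] TT k B :=
  TensorAlgebra.ι k ∘ₗ incl k B n hn

variable {k B}

theorem algHom_ext_letter {A : Type*} [Semiring A] [Algebra k A] {f g : TT k B →ₐ[k] A}
    (h : ∀ (n : ℕ) (hn : 0 < n) (x : Fin n → B), f (letter k B n hn (PiTensorProduct.tprod k x)) =
      g (letter k B n hn (PiTensorProduct.tprod k x))) : f = g := by
  apply TensorAlgebra.hom_ext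
  apply DirectSum.linearMap_ext
  rintro ⟨n, hn⟩
  apply PiTensorProduct.ext
  ext x
  exact h n hn x

end Letters

section Comul

variable {k B : Type*} [Field k] [NonUnitalRing B] [Module k B]

theorem freeComul_eq [Coalgebra k B] (n : ℕ) (a : ⨂[k]^n B) :
    freeComul k B n a =
      unzip k B B n (PiTensorProduct.map (fun _ => Coalgebra.comul (R := k) (A := B)) a) := by
  suffices H : freeComul k B n = unzip k B B n ∘ₗ
      PiTensorProduct.map (fun _ => Coalgebra.comul (R := k) (A := B)) from LinearMap.congr_fun H a
  apply PiTensorProduct.ext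
  ext x
  simp only [LinearMap.compMultilinearMap_apply, LinearMap.comp_apply, PiTensorProduct.map_tprod,
    freeComul_tprod]

theorem restrict_eq_blockProd {n : ℕ} (ρ : Composition n) :
    restrict k B ρ = blockProd (letter k B) ρ := rfl

variable [IsScalarTower k B B] [SMulCommClass k B B]

variable (k B) in
/-- The linear map on `Tⁿ(B ⊗ B)` with `(a₁ ⊗ b₁, …, aₙ ⊗ bₙ) ↦ ∑_ρ a|ρ ⊗ b/ρ`. -/
def pairComul (n : ℕ) (hn : 0 < n) : (⨂[k]^n (B ⊗[k] B)) →ₗ[k] TT k B ⊗[k] TT k B :=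
  (∑ ρ : Composition n, TensorProduct.map (restrict k B ρ) (contractTT k B hn ρ)) ∘ₗ unzip k B B n

/-- Separates the coproduct of `B` from the sum over compositions, so that the latter can be studied
on words of pure tensors. -/
theorem renormComul_letter [Coalgebra k B] (n : ℕ) (hn : 0 < n) (a : ⨂[k]^n B) :
    renormComul k B (letter k B n hn a) =
      pairComul k B n hn (PiTensorProduct.map (fun _ => Coalgebra.comul (R := k) (A := B)) a) := by
  simp only [letter, LinearMap.comp_apply, renormComul, TensorAlgebra.lift_ι_apply, incl,
    DirectSum.toModule_lof, pairComul, LinearMap.sum_apply, freeComul_eq]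

theorem contractTT_eq {n : ℕ} (hn : 0 < n) (ρ : Composition n) (x : ⨂[k]^n B) :
    contractTT k B hn ρ x =
      letter k B ρ.length (ρ.length_pos_of_pos hn) (contract k B ρ x) := rfl

theorem wordMap_pairComul {α : Type*} (a b : α → B) {l : List α} (hl : l ≠ []) :
    wordMap (pairComul k B) (l.map fun i => a i ⊗ₜ b i) =
      ∑ L ∈ splits l, (L.map fun m => wordMap (letter k B) (m.map a)).prod ⊗ₜ
        wordMap (letter k B) (L.map fun m => mulList k (m.map b)) := by
  have hn : 0 < l.length := List.length_pos_iff.2 hl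
  obtain ⟨n, hn', y, rfl⟩ : ∃ (n : ℕ) (_ : 0 < n) (y : Fin n → α), l = List.ofFn y :=
    ⟨l.length, hn, l.get, (List.ofFn_get l).symm⟩
  rw [List.map_ofFn, wordMap_ofFn _ hn', sum_splits (n := n) _ (by simp), pairComul,
    LinearMap.comp_apply]
  have := unzip_tprod (k := k) n (fun i => a (y i)) (fun i => b (y i))
  simp only [Function.comp_def]
  rw [this, LinearMap.sum_apply]
  refine Finset.sum_congr rfl fun ρ _ => ?_
  rw [TensorProduct.map_tmul, restrict_eq_blockProd, blockProd_tprod_list, contractTT_eq,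
    map_contract_tprod_list k (letter k B) hn']

theorem pairComul_tprod_list {α : Type*} {n : ℕ} (hn : 0 < n) (a b : α → B) (y : Fin n → α) :
    pairComul k B n hn (PiTensorProduct.tprod k fun i => a (y i) ⊗ₜ b (y i)) =
      ∑ L ∈ splits (List.ofFn y), (L.map fun m => wordMap (letter k B) (m.map a)).prod ⊗ₜ
        wordMap (letter k B) (L.map fun m => mulList k (m.map b)) := by
  rw [← wordMap_pairComul]
  · rw [← wordMap_ofFn, List.map_ofFn]
    rfl
  · rw [← List.length_pos_iff, List.length_ofFn]
    exact hn

theorem pairComul_tprod {n : ℕ} (hn : 0 < n) (a b : Fin n → B) :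
    pairComul k B n hn (PiTensorProduct.tprod k fun i => a i ⊗ₜ b i) =
      ∑ L ∈ splits (List.finRange n), (L.map fun m => wordMap (letter k B) (m.map a)).prod ⊗ₜ
        wordMap (letter k B) (L.map fun m => mulList k (m.map b)) := by
  rw [← List.ofFn_id]
  exact pairComul_tprod_list hn a b id

/-- The iterated coproduct `(Δ ⊗ id)Δ` without the coproduct of `B`. -/
def iterLeft (n : ℕ) (hn : 0 < n) :
    (⨂[k]^n ((B ⊗[k] B) ⊗[k] B)) →ₗ[k] (TT k B ⊗[k] TT k B) ⊗[k] TT k B :=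
  (∑ ρ : Composition n, TensorProduct.map (blockProd (pairComul k B) ρ) (contractTT k B hn ρ)) ∘ₗ
    unzip k (B ⊗[k] B) B n

/-- The iterated coproduct `(id ⊗ Δ)Δ` without the coproduct of `B`. -/
def iterRight (n : ℕ) (hn : 0 < n) :
    (⨂[k]^n (B ⊗[k] (B ⊗[k] B))) →ₗ[k] TT k B ⊗[k] (TT k B ⊗[k] TT k B) :=
  (∑ ρ : Composition n, TensorProduct.map (restrict k B ρ)
    (pairComul k B ρ.length (ρ.length_pos_of_pos hn) ∘ₗ contract k (B ⊗[k] B) ρ)) ∘ₗ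
    unzip k B (B ⊗[k] B) n

theorem list_prod_map_tmul {α A A' : Type*} [Semiring A] [Algebra k A] [Semiring A'] [Algebra k A']
    (f : α → A) (g : α → A') (l : List α) :
    (l.map fun i => f i ⊗ₜ[k] g i).prod = (l.map f).prod ⊗ₜ (l.map g).prod := by
  induction l with
  | nil => rfl
  | cons i l ih => simp [ih]

theorem iterLeft_tprod {α : Type*} {n : ℕ} (hn : 0 < n) (a b c : α → B) (y : Fin n → α) :
    iterLeft n hn (PiTensorProduct.tprod k fun i => (a (y i) ⊗ₜ[k] b (y i)) ⊗ₜ[k] c (y i)) =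
      ∑ L ∈ splits (List.ofFn y), ∑ N ∈ choices splits L,
        ((N.flatten.map fun m => wordMap (letter k B) (m.map a)).prod ⊗ₜ
          (N.map fun M => wordMap (letter k B) (M.map fun m => mulList k (m.map b))).prod) ⊗ₜ
        wordMap (letter k B) (N.map fun M => mulList k (M.flatten.map c)) := by
  have := unzip_tprod (k := k) n (fun i => a (y i) ⊗ₜ[k] b (y i)) (fun i => c (y i))
  rw [iterLeft, LinearMap.comp_apply, this, LinearMap.sum_apply, sum_splits (n := n) _ (by simp)]
  refine Finset.sum_congr rfl fun ρ _ => ?_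
  rw [TensorProduct.map_tmul, blockProd_tprod_list (pairComul k B) ρ (fun i => a i ⊗ₜ[k] b i),
    contractTT_eq, map_contract_tprod_list k (letter k B) hn]
  have hL : [] ∉ (List.ofFn y).splitWrtComposition ρ := by
    intro h
    rw [splitWrtComposition_ofFn, List.mem_ofFn] at h
    obtain ⟨i, hi⟩ := h
    have := ρ.one_le_blocksFun i
    rw [List.ofFn_eq_nil_iff] at hi
    omega
  -- The product, over the pieces of `L`, of sums over their cuts expands into a sum over one choice
  -- of cut for each piece.
  rw [List.map_congr_left fun l hl => wordMap_pairComul a b (fun h => hL (h ▸ hl)),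
    prod_map_sum, TensorProduct.sum_tmul]
  refine Finset.sum_congr rfl fun N hN => ?_
  obtain ⟨hN, -⟩ := mem_choices_splits.1 hN
  rw [list_prod_map_tmul, ← hN, List.map_map, List.map_flatten, List.prod_flatten, List.map_map]
  rfl

theorem iterRight_tprod {α : Type*} {n : ℕ} (hn : 0 < n) (a b c : α → B) (y : Fin n → α) :
    iterRight n hn (PiTensorProduct.tprod k fun i => a (y i) ⊗ₜ[k] (b (y i) ⊗ₜ[k] c (y i))) =
      ∑ L ∈ splits (List.ofFn y), ∑ N ∈ splits L,
        (N.flatten.map fun m => wordMap (letter k B) (m.map a)).prod ⊗ₜ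
          ((N.map fun M => wordMap (letter k B) (M.map fun m => mulList k (m.map b))).prod ⊗ₜ
        wordMap (letter k B) (N.map fun M => mulList k (M.flatten.map c))) := by
  have := unzip_tprod (k := k) n (fun i => a (y i)) (fun i => b (y i) ⊗ₜ[k] c (y i))
  rw [iterRight, LinearMap.comp_apply, this, LinearMap.sum_apply]
  have hs := sum_splits (n := n) (List.ofFn y) (by simp) (fun L => ∑ N ∈ splits L,
        (N.flatten.map fun m => wordMap (letter k B) (m.map a)).prod ⊗ₜ[k]
          ((N.map fun M => wordMap (letter k B) (M.map fun m => mulList k (m.map b))).prod ⊗ₜ[k]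
        wordMap (letter k B) (N.map fun M => mulList k (M.flatten.map c))))
  rw [hs]
  refine Finset.sum_congr rfl fun ρ _ => ?_
  rw [TensorProduct.map_tmul, restrict_eq_blockProd, blockProd_tprod_list, LinearMap.comp_apply,
    map_contract_tprod_list k (pairComul k B) hn ρ (fun i => b i ⊗ₜ[k] c i)]
  have hL : [] ∉ (List.ofFn y).splitWrtComposition ρ := by
    intro h
    rw [splitWrtComposition_ofFn, List.mem_ofFn] at h
    obtain ⟨i, hi⟩ := h
    have := ρ.one_le_blocksFun i
    rw [List.ofFn_eq_nil_iff] at hi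
    omega
  have hL' : (List.ofFn y).splitWrtComposition ρ ≠ [] := by
    rw [← List.length_pos_iff, List.length_splitWrtComposition]
    exact ρ.length_pos_of_pos hn
  -- The product of a block of letters `b ⊗ c` is again a pure tensor, so the contracted word is one
  -- on which `pairComul` can be expanded.
  rw [List.map_congr_left fun l hl => mulList_tmul k b c (fun h => hL (h ▸ hl)),
    wordMap_pairComul (fun l => mulList k (l.map b)) (fun l => mulList k (l.map c)) hL',
    TensorProduct.tmul_sum]
  refine Finset.sum_congr rfl fun N hN => ?_
  obtain ⟨hN, hN'⟩ := mem_splits.1 hN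
  rw [hN]
  congr 3
  refine List.map_congr_left fun M hM => ?_
  have hM' : [] ∉ M := fun h => hL (hN ▸ List.mem_flatten.2 ⟨M, hM, h⟩)
  rw [List.map_flatten, mulList_flatten, List.map_map]
  · rfl
  · simpa using hM'
  · simpa using fun h : M = [] => hN' (h ▸ hM)

/-- Once both sides are expanded, the summands depend on `N` alone and agree up to rebracketing;
only the two ways of enumerating `N` differ. -/
theorem assoc_iterLeft (n : ℕ) (hn : 0 < n) (t : ⨂[k]^n ((B ⊗[k] B) ⊗[k] B)) :
    TensorProduct.assoc k (TT k B) (TT k B) (TT k B) (iterLeft n hn t) =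
      iterRight n hn (PiTensorProduct.map
        (fun _ => (TensorProduct.assoc k B B B).toLinearMap) t) := by
  suffices H : (TensorProduct.assoc k (TT k B) (TT k B) (TT k B)).toLinearMap ∘ₗ iterLeft n hn =
      iterRight n hn ∘ₗ PiTensorProduct.map
        (fun _ => (TensorProduct.assoc k B B B).toLinearMap) from LinearMap.congr_fun H t
  apply tensorPower_ext_tmul_tmul
  intro a b c
  simp only [LinearMap.comp_apply, PiTensorProduct.map_tprod, LinearEquiv.coe_coe,
    TensorProduct.assoc_tmul]
  refine (congrArg _ (iterLeft_tprod hn a b c id)).trans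
    (Eq.trans ?_ (iterRight_tprod hn a b c id).symm)
  rw [sum_splits_choices]
  simp only [map_sum, TensorProduct.assoc_tmul]

theorem map_renormComul_id [Coalgebra k B] (n : ℕ) (hn : 0 < n) (t : ⨂[k]^n (B ⊗[k] B)) :
    Algebra.TensorProduct.map (renormComul k B) (AlgHom.id k (TT k B)) (pairComul k B n hn t) =
      iterLeft n hn (PiTensorProduct.map
        (fun _ => TensorProduct.map (Coalgebra.comul (R := k) (A := B)) LinearMap.id) t) := by
  suffices H : (Algebra.TensorProduct.map (renormComul k B) (AlgHom.id k (TT k B))).toLinearMap ∘ₗ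
      pairComul k B n hn = iterLeft n hn ∘ₗ PiTensorProduct.map
        (fun _ => TensorProduct.map (Coalgebra.comul (R := k) (A := B)) LinearMap.id) from
    LinearMap.congr_fun H t
  apply tensorPower_ext_tmul
  intro a b
  simp only [LinearMap.comp_apply, PiTensorProduct.map_tprod, TensorProduct.map_tmul, pairComul,
    iterLeft, unzip_tprod, LinearMap.sum_apply, map_sum, AlgHom.toLinearMap_apply,
    Algebra.TensorProduct.map_tmul, LinearMap.id_apply, AlgHom.id_apply]
  refine Finset.sum_congr rfl fun ρ _ => ?_
  rw [restrict_eq_blockProd, comp_blockProd (letter k B) (pairComul k B) (renormComul k B)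
    Coalgebra.comul renormComul_letter, PiTensorProduct.map_tprod]

/-- Here `Δ` hits the single letter `b/ρ`, so the coproduct of `B` must be moved past the products
inside its entries. -/
theorem map_id_renormComul [Coalgebra k B] [IsNonUnitalBialgebra k B] (n : ℕ) (hn : 0 < n)
    (t : ⨂[k]^n (B ⊗[k] B)) :
    Algebra.TensorProduct.map (AlgHom.id k (TT k B)) (renormComul k B) (pairComul k B n hn t) =
      iterRight n hn (PiTensorProduct.map
        (fun _ => TensorProduct.map LinearMap.id (Coalgebra.comul (R := k) (A := B))) t) := by
  suffices H : (Algebra.TensorProduct.map (AlgHom.id k (TT k B)) (renormComul k B)).toLinearMap ∘ₗ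
      pairComul k B n hn = iterRight n hn ∘ₗ PiTensorProduct.map
        (fun _ => TensorProduct.map LinearMap.id (Coalgebra.comul (R := k) (A := B))) from
    LinearMap.congr_fun H t
  apply tensorPower_ext_tmul
  intro a b
  simp only [LinearMap.comp_apply, PiTensorProduct.map_tprod, TensorProduct.map_tmul, pairComul,
    iterRight, unzip_tprod, LinearMap.sum_apply, map_sum, AlgHom.toLinearMap_apply,
    Algebra.TensorProduct.map_tmul, LinearMap.id_apply, AlgHom.id_apply]
  refine Finset.sum_congr rfl fun ρ _ => ?_
  have h := map_contract k (V := B) (V' := B ⊗[k] B) Coalgebra.comul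
    IsNonUnitalBialgebra.comul_mul ρ (PiTensorProduct.tprod k b)
  rw [contractTT_eq, renormComul_letter, h, PiTensorProduct.map_tprod]
  simp only [pairComul, LinearMap.comp_apply, LinearMap.sum_apply]

theorem renormComul_coassoc [Coalgebra k B] [IsNonUnitalBialgebra k B] :
    (Algebra.TensorProduct.assoc k k k (TT k B) (TT k B) (TT k B)).toAlgHom.comp
      ((Algebra.TensorProduct.map (renormComul k B) (AlgHom.id k (TT k B))).comp
        (renormComul k B)) =
    (Algebra.TensorProduct.map (AlgHom.id k (TT k B)) (renormComul k B)).comp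
      (renormComul k B) := by
  apply algHom_ext_letter
  intro n hn x
  simp only [AlgHom.comp_apply, renormComul_letter, map_renormComul_id, map_id_renormComul]
  refine (assoc_iterLeft n hn _).trans ?_
  simp only [PiTensorProduct.map_tprod]
  congr 2
  ext i
  exact Coalgebra.coassoc_apply (x i)

end Comul
end

end Renormalization

/-! ### The counit laws -/

namespace Renormalization

noncomputable section

section Lists

variable {α M : Type*} [AddCommMonoid M]

theorem eq_map_singleton_flatten {L : List (List α)} (h : ∀ l ∈ L, l.length = 1) :
    L = L.flatten.map fun x => [x] := by
  induction L with
  | nil => rfl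
  | cons l L ih =>
    obtain ⟨x, rfl⟩ := List.length_eq_one_iff.1 (h l (by simp))
    simp [← ih fun l hl => h l (by simp [hl])]

/-- Serves `ε ⊗ id`: a factor of `a|ρ` of length other than one is killed by `ε`. -/
theorem sum_splits_eq_singletons (l : List α) (G : List (List α) → M)
    (hG : ∀ L, (∃ m ∈ L, m.length ≠ 1) → G L = 0) :
    ∑ L ∈ splits l, G L = G (l.map fun x => [x]) := by
  refine Finset.sum_eq_single _ (fun L hL hne => hG L ?_) fun h => absurd (mem_splits.2 ⟨?_, ?_⟩) h
  · by_contra! hcon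
    exact hne ((eq_map_singleton_flatten hcon).trans (by rw [(mem_splits.1 hL).1]))
  · rw [← List.flatMap_def]
    exact List.flatMap_singleton' l
  · simp

/-- Serves `id ⊗ ε`: the length of `a/ρ` is the number of blocks, so only one block survives. -/
theorem sum_splits_eq_whole {l : List α} (hl : l ≠ []) (G : List (List α) → M)
    (hG : ∀ L, L.length ≠ 1 → G L = 0) :
    ∑ L ∈ splits l, G L = G [l] := by
  refine Finset.sum_eq_single _ (fun L hL hne => hG L fun h => ?_)
    fun h => absurd (mem_splits.2 ⟨?_, ?_⟩) h
  · obtain ⟨m, rfl⟩ := List.length_eq_one_iff.1 h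
    obtain ⟨rfl, -⟩ := mem_splits.1 hL
    simp at hne
  · simp
  · simpa using hl.symm

end Lists

section Counit

variable {k B : Type*} [Field k] [NonUnitalRing B] [Module k B] [Coalgebra k B]

theorem renormCounit_letter_of_ne_one {n : ℕ} (hn : 0 < n) (h : n ≠ 1) (a : ⨂[k]^n B) :
    renormCounit k B (letter k B n hn a) = 0 := by
  simp only [letter, LinearMap.comp_apply, renormCounit, TensorAlgebra.lift_ι_apply, incl,
    DirectSum.toModule_lof, if_neg h, LinearMap.zero_apply]

theorem renormCounit_wordMap_of_ne_one {l : List B} (h : l.length ≠ 1) :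
    renormCounit k B (wordMap (letter k B) l) = 0 := by
  unfold wordMap
  split_ifs with h'
  · exact renormCounit_letter_of_ne_one _ h _
  · exact map_zero _

theorem renormCounit_wordMap_singleton (x : B) :
    renormCounit k B (wordMap (letter k B) [x]) = Coalgebra.counit x := by
  have h := wordMap_ofFn (letter k B) one_pos (fun _ : Fin 1 => x)
  rw [List.ofFn_succ, List.ofFn_zero] at h
  rw [h]
  simp only [letter, LinearMap.comp_apply, renormCounit, TensorAlgebra.lift_ι_apply, incl,
    DirectSum.toModule_lof, if_true, freeCounit, PiTensorProduct.lift.tprod]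
  simp

variable [IsScalarTower k B B] [SMulCommClass k B B]

theorem counit_mulList [IsNonUnitalBialgebra k B] {l : List B} (hl : l ≠ []) :
    Coalgebra.counit (R := k) (mulList k l) = (l.map (Coalgebra.counit (R := k))).prod := by
  induction l with
  | nil => exact absurd rfl hl
  | cons x l ih =>
    by_cases h : l = []
    · subst h; simp
    · rw [mulList_cons k x h, IsNonUnitalBialgebra.counit_mul, ih h, List.map_cons, List.prod_cons]

/-- The surviving term carries the scalar `∏ ε(aᵢ)`, which multilinearity distributes over the
letters `bᵢ`. -/
theorem map_renormCounit_id (n : ℕ) (hn : 0 < n) (t : ⨂[k]^n (B ⊗[k] B)) :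
    Algebra.TensorProduct.map (renormCounit k B) (AlgHom.id k (TT k B)) (pairComul k B n hn t) =
      1 ⊗ₜ letter k B n hn (PiTensorProduct.map (fun _ => (TensorProduct.lid k B).toLinearMap ∘ₗ
        TensorProduct.map (Coalgebra.counit (R := k) (A := B)) LinearMap.id) t) := by
  suffices H : (Algebra.TensorProduct.map (renormCounit k B)
      (AlgHom.id k (TT k B))).toLinearMap ∘ₗ pairComul k B n hn = TensorProduct.mk k k _ 1 ∘ₗ
      letter k B n hn ∘ₗ PiTensorProduct.map (fun _ => (TensorProduct.lid k B).toLinearMap ∘ₗ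
        TensorProduct.map (Coalgebra.counit (R := k) (A := B)) LinearMap.id) from
    LinearMap.congr_fun H t
  apply tensorPower_ext_tmul
  intro a b
  simp only [LinearMap.comp_apply, PiTensorProduct.map_tprod, TensorProduct.map_tmul,
    pairComul_tprod, map_sum, AlgHom.toLinearMap_apply, LinearEquiv.coe_coe,
    Algebra.TensorProduct.map_tmul, LinearMap.id_apply, AlgHom.id_apply, TensorProduct.lid_tmul,
    TensorProduct.mk_apply]
  rw [sum_splits_eq_singletons, MultilinearMap.map_smul_univ, map_smul, TensorProduct.tmul_smul,
    TensorProduct.smul_tmul', smul_eq_mul, mul_one]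
  · simp only [List.map_map, Function.comp_def, List.map_cons, List.map_nil, mulList_singleton,
      map_list_prod, renormCounit_wordMap_singleton]
    rw [← List.ofFn_eq_map, ← List.ofFn_eq_map, List.prod_ofFn, wordMap_ofFn _ hn]
  · rintro L ⟨m, hm, hm'⟩
    rw [map_list_prod, List.prod_eq_zero, TensorProduct.zero_tmul]
    simp only [List.map_map, List.mem_map]
    exact ⟨m, hm, renormCounit_wordMap_of_ne_one (by simpa using hm')⟩

/-- The surviving term carries `ε(b₁ ⋯ bₙ)`; multiplicativity of the counit turns it into `∏ ε(bᵢ)`.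
-/
theorem map_id_renormCounit [IsNonUnitalBialgebra k B] (n : ℕ) (hn : 0 < n)
    (t : ⨂[k]^n (B ⊗[k] B)) :
    Algebra.TensorProduct.map (AlgHom.id k (TT k B)) (renormCounit k B) (pairComul k B n hn t) =
      letter k B n hn (PiTensorProduct.map (fun _ => (TensorProduct.rid k B).toLinearMap ∘ₗ
        TensorProduct.map LinearMap.id (Coalgebra.counit (R := k) (A := B))) t) ⊗ₜ 1 := by
  suffices H : (Algebra.TensorProduct.map (AlgHom.id k (TT k B))
      (renormCounit k B)).toLinearMap ∘ₗ pairComul k B n hn = (TensorProduct.mk k _ k).flip 1 ∘ₗ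
      letter k B n hn ∘ₗ PiTensorProduct.map (fun _ => (TensorProduct.rid k B).toLinearMap ∘ₗ
        TensorProduct.map LinearMap.id (Coalgebra.counit (R := k) (A := B))) from
    LinearMap.congr_fun H t
  apply tensorPower_ext_tmul
  intro a b
  have hl : List.finRange n ≠ [] := by
    rw [← List.length_pos_iff, List.length_finRange]
    exact hn
  simp only [LinearMap.comp_apply, PiTensorProduct.map_tprod, TensorProduct.map_tmul,
    pairComul_tprod, map_sum, AlgHom.toLinearMap_apply, LinearEquiv.coe_coe,
    Algebra.TensorProduct.map_tmul, LinearMap.id_apply, AlgHom.id_apply, TensorProduct.rid_tmul,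
    LinearMap.flip_apply, TensorProduct.mk_apply]
  rw [sum_splits_eq_whole hl, MultilinearMap.map_smul_univ, map_smul, TensorProduct.smul_tmul,
    smul_eq_mul, mul_one]
  · simp only [List.map_cons, List.map_nil, List.prod_singleton, renormCounit_wordMap_singleton]
    rw [counit_mulList (by simpa using hl), List.map_map, ← List.ofFn_eq_map, ← List.ofFn_eq_map,
      List.prod_ofFn, wordMap_ofFn _ hn]
    rfl
  · intro L hL
    rw [renormCounit_wordMap_of_ne_one (by simpa using hL), TensorProduct.tmul_zero]

variable (k B) in
theorem isBialgebra_renorm [IsNonUnitalBialgebra k B] :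
    IsBialgebra (renormComul k B) (renormCounit k B) where
  coassoc := renormComul_coassoc
  counit_left := by
    apply algHom_ext_letter
    intro n hn x
    simp only [AlgHom.comp_apply, renormComul_letter, map_renormCounit_id,
      PiTensorProduct.map_tprod]
    simp only [LinearMap.comp_apply]
    have (y : B) : TensorProduct.map Coalgebra.counit LinearMap.id (Coalgebra.comul (R := k) y) =
      1 ⊗ₜ[k] y := Coalgebra.rTensor_counit_comul y
    simp [this]
  counit_right := by
    apply algHom_ext_letter
    intro n hn x
    simp only [AlgHom.comp_apply, renormComul_letter, map_id_renormCounit,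
      PiTensorProduct.map_tprod]
    simp only [LinearMap.comp_apply]
    have (y : B) : TensorProduct.map LinearMap.id Coalgebra.counit (Coalgebra.comul (R := k) y) =
      y ⊗ₜ[k] 1 := Coalgebra.lTensor_counit_comul y
    simp [this]

end Counit
end
end Renormalization

/-! ### Orderings of finite sets and of partitions -/

namespace Renormalization

noncomputable section

section Listings

variable {α : Type*} [DecidableEq α]

/-- The lists without repetition whose set of entries is `P`. -/
def listings (P : Finset α) : Finset (List α) :=
  ⟨P.val.lists, Multiset.lists_nodup_finset P⟩

theorem mem_listings {P : Finset α} {l : List α} : l ∈ listings P ↔ l.toFinset = P ∧ l.Nodup := by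
  change l ∈ P.val.lists ↔ _
  rw [Multiset.mem_lists_iff]
  constructor
  · intro h
    have hl : l.Nodup := by
      have := P.nodup
      rw [h] at this
      exact this
    refine ⟨?_, hl⟩
    ext a
    rw [List.mem_toFinset, ← Finset.mem_val, h]
    rfl
  · rintro ⟨rfl, h⟩
    rw [List.toFinset_val, h.dedup]
    rfl

theorem sum_perm_eq_sum_listings {M : Type*} [AddCommMonoid M] {P : Finset α} {n : ℕ}
    (e : Fin n ≃ P) (F : List α → M) :
    ∑ σ : Equiv.Perm (Fin n), F (List.ofFn fun i => (e (σ i) : α)) = ∑ l ∈ listings P, F l := by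
  refine Finset.sum_bij (fun σ _ => List.ofFn fun i => (e (σ i) : α)) ?_ ?_ ?_ fun _ _ => rfl
  · intro σ _
    rw [mem_listings, List.nodup_ofFn]
    refine ⟨?_, fun i j h => σ.injective (e.injective (Subtype.ext h))⟩
    ext a
    rw [List.mem_toFinset, List.mem_ofFn]
    constructor
    · rintro ⟨i, rfl⟩
      exact (e (σ i)).2
    · intro ha
      exact ⟨σ.symm (e.symm ⟨a, ha⟩), by simp⟩
  · intro σ _ τ _ h
    ext i
    have := congrFun (List.ofFn_injective h) i
    rw [e.injective (Subtype.ext this)]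
  · intro l hl
    obtain ⟨rfl, hnd⟩ := mem_listings.1 hl
    obtain rfl : n = l.length := by
      rw [← List.toFinset_card_of_nodup hnd, ← Fintype.card_coe, ← Fintype.card_congr e,
        Fintype.card_fin]
    -- The permutation sends a position to the index, under `e`, of the entry of `l` there; it is
    -- injective because `l` has no repetition.
    let f : Fin l.length → Fin l.length :=
      fun i => e.symm ⟨l.get i, List.mem_toFinset.2 (l.get_mem i)⟩
    have hf : Function.Injective f := fun i j h =>
      hnd.injective_get (congrArg Subtype.val (e.symm.injective h))
    refine ⟨Equiv.ofBijective f (Finite.injective_iff_bijective.1 hf), Finset.mem_univ _, ?_⟩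
    simp only [Equiv.ofBijective_apply, f, Equiv.apply_symm_apply]
    exact List.ofFn_get l

theorem mem_choices_listings {K : List (Finset α)} {L : List (List α)} :
    L ∈ choices listings K ↔ L.map List.toFinset = K ∧ ∀ m ∈ L, m.Nodup :=
  mem_choices_iff_map_eq fun _ _ => mem_listings

/-- Listing the parts of a partition and then the elements of each part amounts to cutting a
listing of the whole set into nonempty pieces. -/
theorem sum_listings_splits {M : Type*} [AddCommMonoid M] (s : Finset α) (G : List (List α) → M) :
    ∑ l ∈ listings s, ∑ L ∈ splits l, G L =
      ∑ π : Finpartition s, ∑ K ∈ listings π.parts, ∑ L ∈ choices listings K, G L := by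
  rw [Finset.sum_sigma']
  simp only [Finset.sum_sigma']
  symm
  -- Everything is recovered from `L`: the ordering of the parts is `K = L.map List.toFinset`, and
  -- the entries of `K` are the parts of `π`.
  refine Finset.sum_bij (fun p _ => ⟨p.2.2.flatten, p.2.2⟩) ?_ ?_ ?_ fun _ _ => rfl
  · rintro ⟨π, K, L⟩ h
    simp only [Finset.mem_sigma, Finset.mem_univ, true_and, mem_listings, mem_choices_listings,
      mem_splits] at h ⊢
    obtain ⟨⟨hK, hK'⟩, rfl, hL⟩ := h
    have hpart : ∀ m ∈ L, m.toFinset ∈ π.parts := fun m hm => by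
      rw [← hK, List.mem_toFinset]
      exact List.mem_map_of_mem hm
    refine ⟨⟨?_, ?_⟩, ?_⟩
    · ext a
      rw [List.mem_toFinset, List.mem_flatten]
      constructor
      · rintro ⟨m, hm, ha⟩
        exact π.le (hpart m hm) (List.mem_toFinset.2 ha)
      · intro ha
        have := π.part_mem.2 ha
        rw [← hK, List.mem_toFinset, List.mem_map] at this
        obtain ⟨m, hm, h⟩ := this
        exact ⟨m, hm, List.mem_toFinset.1 (h ▸ π.mem_part ha)⟩
    · rw [List.nodup_flatten]
      refine ⟨hL, ?_⟩
      rw [List.Nodup, List.pairwise_map] at hK'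
      refine hK'.imp_of_mem fun {m m'} hm hm' hne => ?_
      rw [← List.disjoint_toFinset_iff_disjoint]
      exact π.disjoint (hpart m hm) (hpart m' hm') hne
    · intro h
      exact π.bot_notMem (hpart [] h)
  · rintro ⟨π, K, L⟩ h ⟨π', K', L'⟩ h' heq
    simp only [Finset.mem_sigma, Finset.mem_univ, true_and, mem_listings,
      mem_choices_listings] at h h'
    simp only [Sigma.mk.injEq, heq_eq_eq] at heq
    obtain ⟨-, rfl⟩ := heq
    obtain ⟨⟨hK, -⟩, rfl, -⟩ := h
    obtain ⟨⟨hK', -⟩, rfl, -⟩ := h'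
    obtain rfl : π = π' := Finpartition.ext (hK.symm.trans hK')
    rfl
  · rintro ⟨l, L⟩ h
    simp only [Finset.mem_sigma, mem_listings, mem_splits] at h
    obtain ⟨⟨hs, hl⟩, rfl, hL⟩ := h
    rw [List.nodup_flatten] at hl
    -- A set occurring at two positions would be disjoint from itself, hence empty, but `L` has no
    -- empty piece.
    have hne : (L.map List.toFinset).Nodup := by
      rw [List.Nodup, List.pairwise_map]
      refine hl.2.imp_of_mem fun {m m'} hm hm' hd heq => ?_
      rw [← List.disjoint_toFinset_iff_disjoint, ← heq, disjoint_self] at hd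
      exact hL (List.toFinset_eq_empty_iff _ |>.1 hd ▸ hm)
    have huniq : ∀ m ∈ L, ∀ m' ∈ L, ∀ a ∈ m, a ∈ m' → m = m' := by
      intro m hm m' hm' a ha ha'
      by_contra hne
      have : Std.Symm (List.Disjoint (α := α)) := ⟨fun _ _ h => h.symm⟩
      exact hl.2.forall hm hm' hne ha ha'
    let π : Finpartition s := Finpartition.ofExistsUnique (L.map List.toFinset).toFinset
      (by
        intro p hp
        rw [List.mem_toFinset, List.mem_map] at hp
        obtain ⟨m, hm, rfl⟩ := hp
        intro a ha
        rw [← hs, List.mem_toFinset, List.mem_flatten]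
        exact ⟨m, hm, List.mem_toFinset.1 ha⟩)
      (by
        intro a ha
        rw [← hs, List.mem_toFinset, List.mem_flatten] at ha
        obtain ⟨m, hm, ha⟩ := ha
        refine ⟨m.toFinset, ⟨?_, List.mem_toFinset.2 ha⟩, ?_⟩
        · rw [List.mem_toFinset]
          exact List.mem_map_of_mem hm
        · rintro p ⟨hp, hap⟩
          rw [List.mem_toFinset, List.mem_map] at hp
          obtain ⟨m', hm', rfl⟩ := hp
          rw [huniq m hm m' hm' a ha (List.mem_toFinset.1 hap)])
      (by
        rw [List.mem_toFinset, List.mem_map]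
        rintro ⟨m, hm, h⟩
        exact hL (List.toFinset_eq_empty_iff _ |>.1 h ▸ hm))
    refine ⟨⟨π, L.map List.toFinset, L⟩, ?_, rfl⟩
    simp only [Finset.mem_sigma, Finset.mem_univ, true_and, mem_listings, mem_choices_listings]
    exact ⟨⟨rfl, hne⟩, hl.1⟩

end Listings

end
end Renormalization

/-! ### Braces and the sum over set partitions -/

namespace Renormalization

noncomputable section

section Braces

variable {k B : Type*} [Field k] [NonUnitalRing B] [Module k B]

theorem alpha_incl_tprod {n : ℕ} (hn : 0 < n) (x : Fin n → B) :
    alpha k B (incl k B n hn (PiTensorProduct.tprod k x)) =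
      ∑ σ : Equiv.Perm (Fin n), incl k B n hn (PiTensorProduct.tprod k fun i => x (σ i)) := by
  rw [← map_sum]
  simp only [alpha, incl, DirectSum.lmap_lof]
  congr 1
  simp only [symmetrizer, LinearMap.sum_apply, LinearEquiv.coe_coe, PiTensorProduct.reindex_tprod,
    Equiv.symm_symm]

/-- The image in `S(T(B)⁺)` of a nonempty word. -/
def symWord (l : List B) : ST k B :=
  SymmetricAlgebra.algHom k (TPlus k B) (wordMap (letter k B) l)

theorem symWord_ofFn {n : ℕ} (hn : 0 < n) (x : Fin n → B) :
    symWord (k := k) (List.ofFn x) =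
      SymmetricAlgebra.ι k (TPlus k B) (incl k B n hn (PiTensorProduct.tprod k x)) := by
  rw [symWord, wordMap_ofFn _ hn]
  rfl

theorem inclSS_ι (z : SPlus k B) :
    inclSS k B (SymmetricAlgebra.ι k (SPlus k B) z) = SymmetricAlgebra.ι k (TPlus k B) z := by
  rw [inclSS, SymmetricAlgebra.lift_ι_apply]
  rfl

/-- Inside `S(T(B)⁺)` a brace becomes a sum over the orderings of its index set, which brings set
partitions into the language of lists. -/
theorem inclSS_braceFamily {α : Type*} [DecidableEq α] (P : Finset α) [Nonempty P] (x : α → B) :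
    inclSS k B (SymmetricAlgebra.ι k (SPlus k B) (braceFamily k B P fun j => x j)) =
      ∑ l ∈ listings P, symWord (l.map x) := by
  have e := (Fintype.equivFin P).symm
  rw [braceFamily_apply k B P _ e, inclSS_ι]
  change SymmetricAlgebra.ι k (TPlus k B) (alpha k B _) = _
  rw [alpha_incl_tprod, map_sum, ← sum_perm_eq_sum_listings e fun l => symWord (l.map x)]
  refine Finset.sum_congr rfl fun σ _ => ?_
  rw [List.map_ofFn, Function.comp_def, symWord_ofFn Fintype.card_pos]

end Braces

section SetPartitions

variable {k B : Type*} [Field k] [NonUnitalCommRing B] [Module k B]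

theorem restrictSet_tprod {n : ℕ} (π : SetPartition n) (x : Fin n → B) :
    restrictSet k B π (PiTensorProduct.tprod k x) =
      ∏ P : π.parts, SymmetricAlgebra.ι k (SPlus k B) (braceFamily k B P.1 fun j => x j) := by
  rw [restrictSet, PiTensorProduct.lift.tprod]
  rfl

variable [IsScalarTower k B B] [SMulCommClass k B B]

theorem contractSet_tprod {n : ℕ} (hn : 0 < n) (π : SetPartition n) (x : Fin n → B) :
    haveI := π.nonempty_parts hn
    contractSet k B hn π (PiTensorProduct.tprod k x) =
      braceFamily k B π.parts fun P => mulFamily k B P.1 fun j => x j := by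
  rw [contractSet, PiTensorProduct.lift.tprod]
  rfl

/-- By commutativity of `B`, any ordering of the block computes its product. -/
theorem mulFamily_eq_mulList {α : Type*} [DecidableEq α] {P : Finset α} {l : List α}
    (hl : l ∈ listings P) (x : α → B) : (mulFamily k B P fun j => x j) = mulList k (l.map x) := by
  obtain ⟨rfl, hnd⟩ := mem_listings.1 hl
  rw [mulList, List.map_map, ← List.prod_toFinset _ hnd, ← Finset.prod_coe_sort]
  rfl

/-- The ordering `K` of the blocks comes from the brace on the right, the orderings inside the
blocks from the braces on the left. The product on the left may be taken in the order `K` since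
`S(T(B)⁺)` is commutative, and the products on the right may be taken in the inner orders since `B`
is. -/
theorem map_inclSS_restrictSet_contractSet {n : ℕ} (hn : 0 < n) (π : SetPartition n)
    (a b : Fin n → B) :
    inclSS k B (restrictSet k B π (PiTensorProduct.tprod k a)) ⊗ₜ[k]
        inclSS k B (contractSetSS k B hn π (PiTensorProduct.tprod k b)) =
      ∑ K ∈ listings π.parts, ∑ L ∈ choices listings K,
        (L.map fun m => symWord (k := k) (m.map a)).prod ⊗ₜ[k]
          symWord (k := k) (L.map fun m => mulList k (m.map b)) := by
  have := π.nonempty_parts hn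
  rw [contractSetSS, LinearMap.comp_apply, contractSet_tprod,
    inclSS_braceFamily π.parts fun P => mulFamily k B P fun j => b j, TensorProduct.tmul_sum]
  refine Finset.sum_congr rfl fun K hK => ?_
  obtain ⟨hK, hnd⟩ := mem_listings.1 hK
  rw [restrictSet_tprod, map_prod]
  simp only [inclSS_braceFamily]
  rw [Finset.prod_coe_sort π.parts fun P => ∑ l ∈ listings P, symWord (l.map a), ← hK,
    List.prod_toFinset _ hnd, prod_map_sum, TensorProduct.sum_tmul]
  refine Finset.sum_congr rfl fun L hL => ?_
  congr 2
  obtain ⟨rfl, hLnd⟩ := mem_choices_listings.1 hL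
  rw [List.map_map]
  refine List.map_congr_left fun m hm => ?_
  exact mulFamily_eq_mulList (mem_listings.2 ⟨rfl, hLnd m hm⟩) b

theorem sum_perm_pairComul {n : ℕ} (hn : 0 < n) (t : ⨂[k]^n (B ⊗[k] B)) :
    ∑ σ : Equiv.Perm (Fin n),
      Algebra.TensorProduct.map (SymmetricAlgebra.algHom k (TPlus k B))
        (SymmetricAlgebra.algHom k (TPlus k B))
        (pairComul k B n hn (PiTensorProduct.reindex k (fun _ => B ⊗[k] B) σ.symm t)) =
      Algebra.TensorProduct.map (inclSS k B) (inclSS k B) (∑ π : SetPartition n,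
        TensorProduct.map (restrictSet k B π) (contractSetSS k B hn π) (unzip k B B n t)) := by
  suffices H : ∑ σ : Equiv.Perm (Fin n),
      (Algebra.TensorProduct.map (SymmetricAlgebra.algHom k (TPlus k B))
        (SymmetricAlgebra.algHom k (TPlus k B))).toLinearMap ∘ₗ
        pairComul k B n hn ∘ₗ (PiTensorProduct.reindex k (fun _ => B ⊗[k] B) σ.symm).toLinearMap =
      (Algebra.TensorProduct.map (inclSS k B) (inclSS k B)).toLinearMap ∘ₗ (∑ π : SetPartition n,
        TensorProduct.map (restrictSet k B π) (contractSetSS k B hn π)) ∘ₗ unzip k B B n by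
    have := LinearMap.congr_fun H t
    simpa only [LinearMap.sum_apply, LinearMap.comp_apply, AlgHom.toLinearMap_apply,
      LinearEquiv.coe_coe] using this
  apply tensorPower_ext_tmul
  intro a b
  simp only [LinearMap.sum_apply, LinearMap.comp_apply, AlgHom.toLinearMap_apply,
    LinearEquiv.coe_coe, unzip_tprod, TensorProduct.map_tmul, map_sum,
    Algebra.TensorProduct.map_tmul, map_inclSS_restrictSet_contractSet,
    PiTensorProduct.reindex_tprod, Equiv.symm_symm]
  -- Both sides become sums over orderings of `{1, …, n}` cut into pieces, the permutation `σ`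
  -- supplying the ordering.
  rw [← sum_listings_splits,
    ← sum_perm_eq_sum_listings (Equiv.subtypeUnivEquiv Finset.mem_univ).symm]
  refine Finset.sum_congr rfl fun σ _ => ?_
  rw [pairComul_tprod_list hn a b σ, map_sum]
  refine Finset.sum_congr rfl fun L _ => ?_
  rw [Algebra.TensorProduct.map_tmul, map_list_prod, List.map_map]
  rfl

end SetPartitions

end
end Renormalization

/-! ### Transfer of bialgebra structures to quotients and subalgebras -/

namespace Renormalization

noncomputable section

section Transfer

variable {k A A' : Type*} [CommSemiring k] [Semiring A] [Algebra k A] [Semiring A'] [Algebra k A']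
  {Δ : A →ₐ[k] A ⊗[k] A} {ε : A →ₐ[k] k} {Δ' : A' →ₐ[k] A' ⊗[k] A'} {ε' : A' →ₐ[k] k}
  {f : A →ₐ[k] A'}

theorem IsBialgebraMap.map_comul_apply (hf : IsBialgebraMap Δ ε Δ' ε' f) (x : A) :
    Δ' (f x) = Algebra.TensorProduct.map f f (Δ x) :=
  (DFunLike.congr_fun hf.map_comul x).symm

theorem IsBialgebraMap.map_counit_apply (hf : IsBialgebraMap Δ ε Δ' ε' f) (x : A) :
    ε' (f x) = ε x :=
  DFunLike.congr_fun hf.map_counit x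

theorem IsBialgebraMap.map_comul_id (hf : IsBialgebraMap Δ ε Δ' ε' f) (t : A ⊗[k] A) :
    Algebra.TensorProduct.map Δ' (AlgHom.id k A') (Algebra.TensorProduct.map f f t) =
      Algebra.TensorProduct.map (Algebra.TensorProduct.map f f) f
        (Algebra.TensorProduct.map Δ (AlgHom.id k A) t) := by
  induction t with
  | zero => simp only [map_zero]
  | add x y hx hy => simp only [map_add, hx, hy]
  | tmul x y => simp [hf.map_comul_apply]

theorem IsBialgebraMap.map_id_comul (hf : IsBialgebraMap Δ ε Δ' ε' f) (t : A ⊗[k] A) :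
    Algebra.TensorProduct.map (AlgHom.id k A') Δ' (Algebra.TensorProduct.map f f t) =
      Algebra.TensorProduct.map f (Algebra.TensorProduct.map f f)
        (Algebra.TensorProduct.map (AlgHom.id k A) Δ t) := by
  induction t with
  | zero => simp only [map_zero]
  | add x y hx hy => simp only [map_add, hx, hy]
  | tmul x y => simp [hf.map_comul_apply]

theorem IsBialgebraMap.map_counit_id (hf : IsBialgebraMap Δ ε Δ' ε' f) (t : A ⊗[k] A) :
    Algebra.TensorProduct.map ε' (AlgHom.id k A') (Algebra.TensorProduct.map f f t) =
      Algebra.TensorProduct.map (AlgHom.id k k) f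
        (Algebra.TensorProduct.map ε (AlgHom.id k A) t) := by
  induction t with
  | zero => simp only [map_zero]
  | add x y hx hy => simp only [map_add, hx, hy]
  | tmul x y => simp [hf.map_counit_apply]

theorem IsBialgebraMap.map_id_counit (hf : IsBialgebraMap Δ ε Δ' ε' f) (t : A ⊗[k] A) :
    Algebra.TensorProduct.map (AlgHom.id k A') ε' (Algebra.TensorProduct.map f f t) =
      Algebra.TensorProduct.map f (AlgHom.id k k)
        (Algebra.TensorProduct.map (AlgHom.id k A) ε t) := by
  induction t with
  | zero => simp only [map_zero]
  | add x y hx hy => simp only [map_add, hx, hy]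
  | tmul x y => simp [hf.map_counit_apply]

theorem assoc_map_map (f : A →ₐ[k] A') (t : (A ⊗[k] A) ⊗[k] A) :
    Algebra.TensorProduct.assoc k k k A' A' A'
        (Algebra.TensorProduct.map (Algebra.TensorProduct.map f f) f t) =
      Algebra.TensorProduct.map f (Algebra.TensorProduct.map f f)
        (Algebra.TensorProduct.assoc k k k A A A t) := by
  have h : (Algebra.TensorProduct.assoc k k k A' A' A').toAlgHom.comp
      (Algebra.TensorProduct.map (Algebra.TensorProduct.map f f) f) =
    (Algebra.TensorProduct.map f (Algebra.TensorProduct.map f f)).comp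
      (Algebra.TensorProduct.assoc k k k A A A).toAlgHom := by
    ext <;> simp [Algebra.TensorProduct.one_def]
  exact DFunLike.congr_fun h t

/-- A quotient of a bialgebra is a bialgebra. -/
theorem IsBialgebra.of_surjective (h : IsBialgebra Δ ε) (hf : IsBialgebraMap Δ ε Δ' ε' f)
    (hs : Function.Surjective f) : IsBialgebra Δ' ε' where
  coassoc := by
    rw [← AlgHom.cancel_right hs]
    ext x
    have hx := DFunLike.congr_fun h.coassoc x
    simp only [AlgHom.comp_apply] at hx ⊢
    rw [hf.map_comul_apply, hf.map_comul_id, hf.map_id_comul, ← hx]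
    exact assoc_map_map f _
  counit_left := by
    rw [← AlgHom.cancel_right hs]
    ext x
    have hx := DFunLike.congr_fun h.counit_left x
    simp only [AlgHom.comp_apply] at hx ⊢
    rw [hf.map_comul_apply, hf.map_counit_id, hx]
    simp
  counit_right := by
    rw [← AlgHom.cancel_right hs]
    ext x
    have hx := DFunLike.congr_fun h.counit_right x
    simp only [AlgHom.comp_apply] at hx ⊢
    rw [hf.map_comul_apply, hf.map_id_counit, hx]
    simp

theorem map_comp_map_eq_id {C D C' D' : Type*} [Semiring C] [Algebra k C] [Semiring D]
    [Algebra k D] [Semiring C'] [Algebra k C'] [Semiring D'] [Algebra k D']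
    {f : C →ₐ[k] D} {g : D →ₐ[k] C} {f' : C' →ₐ[k] D'} {g' : D' →ₐ[k] C'}
    (h : g.comp f = AlgHom.id k C) (h' : g'.comp f' = AlgHom.id k C') :
    (Algebra.TensorProduct.map g g').comp (Algebra.TensorProduct.map f f') = AlgHom.id k _ := by
  rw [← Algebra.TensorProduct.map_comp, h, h', Algebra.TensorProduct.map_id]

theorem injective_of_comp_eq_id {f : A →ₐ[k] A'} {g : A' →ₐ[k] A} (h : g.comp f = AlgHom.id k A) :
    Function.Injective f :=
  Function.LeftInverse.injective (g := g) fun x => DFunLike.congr_fun h x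

/-- A subalgebra, split as an algebra, that is stable under the structure maps of a bialgebra is a
bialgebra. -/
theorem IsBialgebra.of_split (h : IsBialgebra Δ' ε') (hf : IsBialgebraMap Δ ε Δ' ε' f)
    {g : A' →ₐ[k] A} (hg : g.comp f = AlgHom.id k A) : IsBialgebra Δ ε where
  coassoc := by
    ext x
    -- The threefold tensor power of `g` is a left inverse of that of `f`, so the axiom may be
    -- checked after applying `f` in each factor.
    apply injective_of_comp_eq_id
      (map_comp_map_eq_id hg (map_comp_map_eq_id hg hg))
    have hx := DFunLike.congr_fun h.coassoc (f x)
    simp only [AlgHom.comp_apply] at hx ⊢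
    rw [hf.map_comul_apply, hf.map_comul_id, hf.map_id_comul] at hx
    rw [← hx]
    exact (assoc_map_map f _).symm
  counit_left := by
    ext x
    apply injective_of_comp_eq_id (map_comp_map_eq_id (AlgHom.id_comp (AlgHom.id k k)) hg)
    have hx := DFunLike.congr_fun h.counit_left (f x)
    simp only [AlgHom.comp_apply] at hx ⊢
    rw [hf.map_comul_apply, hf.map_counit_id] at hx
    rw [hx]
    simp
  counit_right := by
    ext x
    apply injective_of_comp_eq_id (map_comp_map_eq_id hg (AlgHom.id_comp (AlgHom.id k k)))
    have hx := DFunLike.congr_fun h.counit_right (f x)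
    simp only [AlgHom.comp_apply] at hx ⊢
    rw [hf.map_comul_apply, hf.map_id_counit] at hx
    rw [hx]
    simp

end Transfer

/-! ### The bialgebras `S(T(B)⁺)` and `S(S(B)⁺)` -/

section Symmetric

variable (k B : Type*) [Field k] [NonUnitalRing B] [Module k B]

/-- Over a field the subspace `S(B)⁺` has a linear retraction, and the symmetric algebra is
functorial. -/
theorem exists_comp_inclSS_eq_id :
    ∃ r : ST k B →ₐ[k] SS k B, r.comp (inclSS k B) = AlgHom.id k (SS k B) := by
  obtain ⟨p, hp⟩ := LinearMap.exists_leftInverse_of_injective (V := SPlus k B) (V' := TPlus k B)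
    (SPlus k B).subtype (SPlus k B).ker_subtype
  refine ⟨SymmetricAlgebra.lift (SymmetricAlgebra.ι k (SPlus k B) ∘ₗ p), ?_⟩
  apply SymmetricAlgebra.algHom_ext
  ext z
  change SymmetricAlgebra.lift _ (inclSS k B (SymmetricAlgebra.ι k _ z)) =
    SymmetricAlgebra.ι k _ z
  rw [inclSS_ι, SymmetricAlgebra.lift_ι_apply, LinearMap.comp_apply]
  exact congrArg _ (LinearMap.congr_fun hp z)

variable [Coalgebra k B]

/-- The counit of `S(T(B)⁺)`. -/
def symCounit : ST k B →ₐ[k] k :=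
  SymmetricAlgebra.lift ((renormCounit k B).toLinearMap ∘ₗ TensorAlgebra.ι k)

theorem symCounit_ι (z : TPlus k B) :
    symCounit k B (SymmetricAlgebra.ι k (TPlus k B) z) =
      renormCounit k B (TensorAlgebra.ι k z) :=
  SymmetricAlgebra.lift_ι_apply _ _

variable [IsScalarTower k B B] [SMulCommClass k B B]

/-- The coproduct of `S(T(B)⁺)`. -/
def symComul : ST k B →ₐ[k] ST k B ⊗[k] ST k B :=
  SymmetricAlgebra.lift ((Algebra.TensorProduct.map (SymmetricAlgebra.algHom k (TPlus k B))
    (SymmetricAlgebra.algHom k (TPlus k B))).toLinearMap ∘ₗ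
      (renormComul k B).toLinearMap ∘ₗ TensorAlgebra.ι k)

theorem symComul_ι (z : TPlus k B) :
    symComul k B (SymmetricAlgebra.ι k (TPlus k B) z) =
      Algebra.TensorProduct.map (SymmetricAlgebra.algHom k (TPlus k B))
        (SymmetricAlgebra.algHom k (TPlus k B)) (renormComul k B (TensorAlgebra.ι k z)) :=
  SymmetricAlgebra.lift_ι_apply _ _

/-- The structure maps of `S(T(B)⁺)` are the extensions of the values prescribed on generators, so
agreement on `T(B)⁺` suffices. -/
theorem isBialgebraMap_algHom : IsBialgebraMap (renormComul k B) (renormCounit k B)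
    (symComul k B) (symCounit k B) (SymmetricAlgebra.algHom k (TPlus k B)) where
  map_comul := by
    apply TensorAlgebra.hom_ext
    apply LinearMap.ext
    exact fun z => (symComul_ι k B z).symm
  map_counit := by
    apply TensorAlgebra.hom_ext
    apply LinearMap.ext
    exact symCounit_ι k B

end Symmetric

section SymmetricSub

variable {k B : Type*} [Field k] [NonUnitalCommRing B] [Module k B]
  [IsScalarTower k B B] [SMulCommClass k B B] [Coalgebra k B]

/-- The brace is a sum of permuted words, and the coproduct of `B`, acting letter by letter,
commutes with permutations. What remains is `sum_perm_pairComul`. -/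
theorem symComul_brace {n : ℕ} (hn : 0 < n) (a : ⨂[k]^n B) :
    symComul k B (inclSS k B (SymmetricAlgebra.ι k (SPlus k B) (brace k B (incl k B n hn a)))) =
      Algebra.TensorProduct.map (inclSS k B) (inclSS k B) (∑ π : SetPartition n,
        TensorProduct.map (restrictSet k B π) (contractSetSS k B hn π) (freeComul k B n a)) := by
  rw [freeComul_eq, ← sum_perm_pairComul hn, inclSS_ι, symComul_ι]
  change Algebra.TensorProduct.map _ _ (renormComul k B (TensorAlgebra.ι k
    (alpha k B (incl k B n hn a)))) = _
  have h : TensorAlgebra.ι k (alpha k B (incl k B n hn a)) = ∑ σ : Equiv.Perm (Fin n),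
      letter k B n hn (PiTensorProduct.reindex k (fun _ => B) σ.symm a) := by
    rw [alpha, incl, DirectSum.lmap_lof, ← map_sum]
    simp only [symmetrizer, LinearMap.sum_apply]
    rfl
  rw [h, map_sum, map_sum]
  refine Finset.sum_congr rfl fun σ _ => ?_
  have h := PiTensorProduct.map_reindex (R := k)
    (fun _ : Fin n => Coalgebra.comul (R := k) (A := B)) σ.symm a
  rw [renormComul_letter, h]

theorem exists_comul_SS :
    ∃ ΔSS : SS k B →ₐ[k] SS k B ⊗[k] SS k B,
      (Algebra.TensorProduct.map (inclSS k B) (inclSS k B)).comp ΔSS =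
        (symComul k B).comp (inclSS k B) ∧
      ∀ (n : ℕ) (hn : 0 < n) (a : ⨂[k]^n B),
        ΔSS (SymmetricAlgebra.ι k (SPlus k B) (brace k B (incl k B n hn a))) =
          ∑ π : SetPartition n,
            TensorProduct.map (restrictSet k B π) (contractSetSS k B hn π)
              (freeComul k B n a) := by
  obtain ⟨r, hr⟩ := exists_comp_inclSS_eq_id k B
  have hrr (t) : Algebra.TensorProduct.map r r
      (Algebra.TensorProduct.map (inclSS k B) (inclSS k B) t) = t :=
    DFunLike.congr_fun (map_comp_map_eq_id hr hr) t
  -- By `symComul_brace` the coproduct of a brace lies in the image of `inclSS ⊗ inclSS`, so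
  -- applying `r ⊗ r` to it loses nothing.
  let ΔSS : SS k B →ₐ[k] SS k B ⊗[k] SS k B :=
    (Algebra.TensorProduct.map r r).comp ((symComul k B).comp (inclSS k B))
  have hΔ : ∀ (n : ℕ) (hn : 0 < n) (a : ⨂[k]^n B),
      ΔSS (SymmetricAlgebra.ι k (SPlus k B) (brace k B (incl k B n hn a))) =
        ∑ π : SetPartition n,
          TensorProduct.map (restrictSet k B π) (contractSetSS k B hn π) (freeComul k B n a) := by
    intro n hn a
    rw [← hrr (∑ π, _), ← symComul_brace]
    rfl
  refine ⟨ΔSS, ?_, hΔ⟩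
  apply SymmetricAlgebra.algHom_ext
  -- Braces exhaust `S(B)⁺`, so the two algebra maps need only be compared on braces of homogeneous
  -- elements.
  have h : (brace k B).range = ⊤ := LinearMap.range_eq_top.2 (alpha k B).surjective_rangeRestrict
  rw [← LinearMap.cancel_right (LinearMap.range_eq_top.1 h)]
  apply DirectSum.linearMap_ext
  rintro ⟨n, hn⟩
  apply LinearMap.ext
  intro a
  change Algebra.TensorProduct.map (inclSS k B) (inclSS k B)
    (ΔSS (SymmetricAlgebra.ι k (SPlus k B) (brace k B (incl k B n hn a)))) =
    symComul k B (inclSS k B (SymmetricAlgebra.ι k (SPlus k B) (brace k B (incl k B n hn a))))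
  rw [hΔ, symComul_brace]

end SymmetricSub

end
end Renormalization

theorem theorem2 (k B : Type*) [Field k] [CharZero k] [NonUnitalCommRing B] [Module k B]
    [IsScalarTower k B B] [SMulCommClass k B B] [Coalgebra k B] [IsNonUnitalBialgebra k B] :
    -- `T(T(B)⁺)` is a bialgebra,
    IsBialgebra (renormComul k B) (renormCounit k B) ∧
    ∃ (ΔST : ST k B →ₐ[k] ST k B ⊗[k] ST k B) (εST : ST k B →ₐ[k] k),
      -- `S(T(B)⁺)` is a quotient bialgebra of it,
      IsBialgebra ΔST εST ∧
      Function.Surjective (SymmetricAlgebra.algHom k (TPlus k B)) ∧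
      IsBialgebraMap (renormComul k B) (renormCounit k B) ΔST εST
        (SymmetricAlgebra.algHom k (TPlus k B)) ∧
      -- and `S(S(B)⁺)` is a subbialgebra of `S(T(B)⁺)`,
      Function.Injective (inclSS k B) ∧
      ∃ (ΔSS : SS k B →ₐ[k] SS k B ⊗[k] SS k B) (εSS : SS k B →ₐ[k] k),
        IsBialgebra ΔSS εSS ∧
        IsBialgebraMap ΔSS εSS ΔST εST (inclSS k B) ∧
        -- whose coproduct is given by the sum over set partitions.
        ∀ (n : ℕ) (hn : 0 < n) (a : ⨂[k]^n B),
          ΔSS (SymmetricAlgebra.ι k (SPlus k B) (brace k B (incl k B n hn a))) =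
            ∑ π : SetPartition n,
              TensorProduct.map (restrictSet k B π) (contractSetSS k B hn π)
                (freeComul k B n a) := by
  have hq := SymmetricAlgebra.algHom_surjective k (TPlus k B)
  have hST := (isBialgebra_renorm k B).of_surjective (isBialgebraMap_algHom k B) hq
  obtain ⟨r, hr⟩ := exists_comp_inclSS_eq_id k B
  obtain ⟨ΔSS, hcomul, hΔ⟩ := exists_comul_SS (k := k) (B := B)
  have hi : IsBialgebraMap ΔSS ((symCounit k B).comp (inclSS k B)) (symComul k B) (symCounit k B)
      (inclSS k B) := ⟨hcomul, rfl⟩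
  exact ⟨isBialgebra_renorm k B, symComul k B, symCounit k B, hST, hq, isBialgebraMap_algHom k B,
    injective_of_comp_eq_id hr, ΔSS, _, hST.of_split hi hr, hi, hΔ⟩
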